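/- Let $D$ be a positive integer. For a real number $a$ and $n\in\mathbb{N}=\{0,1,2,\dots\}$ write $(a)_n=a(a+1)\cdots(a+n-1)$, and let $${}_4F_3\!\left[\begin{matrix}a_1,a_2,a_3,a_4\\ b_1,b_2,b_3\end{matrix};z\right]=\sum_{n=0}^{\infty}\frac{(a_1)_n(a_2)_n(a_3)_n(a_4)_n}{(b_1)_n(b_2)_n(b_3)_n}\frac{z^n}{n!},$$ where in a terminating series the terms of the form $0/0$ past the point of termination are taken to be $0$. **The polynomials $u_t$ and the scalars $\theta_i$.** Define $$c_i=\frac{3(D-i+1)i(D+i+1)}{D(D+2)(2i+1)}\ (1\le i\le D),\qquad a_i=\frac{3i(i+1)}{D(D+2)}\ (0\le i\le D),$$ $$b_i=\frac{3(D-i)(i+1)(D+i+2)}{D(D+2)(2i+1)}\ (0\le i\le D-1),\qquad \theta_i=3-2a_i\ (0\le i\le D),$$ and let $u_0,u_1,\dots,u_D\in\mathbb{R}[\lambda]$ be the polynomials with $u_0=1$, $u_1=\lambda/3$ and $\lambda u_i=b_iu_{i+1}+a_iu_i+c_iu_{i-1}$ for $1\le i\le D-1$. **The Racah coefficients.** A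 triple $(a,b,c)$ of elements of $\tfrac12\mathbb{N}$ is admissible if $a+b+c\in\mathbb{N}$, $a\le b+c$, $b\le c+a$ and $c\le a+b$; for such a triple put $$\Delta(a,b,c)=\left(\frac{(a+b-c)!\,(b+c-a)!\,(c+a-b)!}{(a+b+c+1)!}\right)^{1/2}\ge 0.$$ For $a,b,c,d,e,f\in\tfrac12\mathbb{N}$ let $W(a,b,c,d;e,f)=0$ unless all of $(a,b,e)$, $(c,d,e)$, $(a,c,f)$, $(b,d,f)$ are admissible, in which case $$W(a,b,c,d;e,f)=\frac{\Delta(a,b,e)\Delta(c,d,e)\Delta(a,c,f)\Delta(b,d,f)\,(\beta_1+1)!\,(-1)^{\beta_1-(a+b+c+d)}}{(\beta_2-\beta_1)!\,(\beta_3-\beta_1)!\,\prod_{k=1}^4(\beta_1-\alpha_k)!}\;{}_4F_3\!\left[\begin{matrix}\alpha_1-\beta_1,\ \alpha_2-\beta_1,\ \alpha_3-\beta_1,\ \alpha_4-\beta_1\\ -\beta_1-1,\ \beta_2-\beta_1+1,\ \beta_3-\beta_1+1\end{matrix};1\right],$$ where $(\alpha_1,\alpha_2,\alpha_3,\alpha_4)=(a+b+e,\;c+d+e,\;a+c+f,\;b+d+f)$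 and $\beta_1\le\beta_2\le\beta_3$ are the numbers $a+b+c+d$, $a+d+e+f$, $b+c+e+f$ in increasing order. **Proposition.** For all integers $h,i,j$ with $0\le h,i,j\le D$, $$\sum_{t=0}^{D}(2t+1)\,u_t(\theta_h)\,u_t(\theta_i)\,u_t(\theta_j)=(D+1)^3\,\Bigl(W\bigl(\tfrac D2,\tfrac D2,i,h;j,\tfrac D2\bigr)\Bigr)^2 .$$ -/

import Mathlib

open Polynomial
open scoped Nat

noncomputable section

namespace RacahKT

/-- The rising factorial `(a)_n = a (a+1) ⋯ (a+n-1)`. -/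
def poch (a : ℝ) (n : ℕ) : ℝ := ∏ k ∈ Finset.range n, (a + k)

/-- The hypergeometric series `₄F₃[a₁,a₂,a₃,a₄; b₁,b₂,b₃; z]`.
In a terminating series whose lower parameters include a negative integer, the terms past
the point of termination, which would read `0/0`, are zero; here this is `x / 0 = 0`. -/
def hyp4F3 (a₁ a₂ a₃ a₄ b₁ b₂ b₃ z : ℝ) : ℝ :=
  ∑' n : ℕ, poch a₁ n * poch a₂ n * poch a₃ n * poch a₄ n /
    (poch b₁ n * poch b₂ n * poch b₃ n) * (z ^ n / (n ! : ℝ))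

/-- `c_i`, used for `1 ≤ i ≤ D`. -/
def cCoeff (D i : ℕ) : ℝ :=
  3 * ((D : ℝ) - i + 1) * i * (D + i + 1) / (D * (D + 2) * (2 * i + 1))

/-- `a_i`, used for `0 ≤ i ≤ D`. -/
def aCoeff (D i : ℕ) : ℝ := 3 * (i : ℝ) * (i + 1) / (D * (D + 2))

/-- `b_i`, used for `0 ≤ i ≤ D - 1`. -/
def bCoeff (D i : ℕ) : ℝ :=
  3 * ((D : ℝ) - i) * (i + 1) * (D + i + 2) / (D * (D + 2) * (2 * i + 1))

/-- `θ_i = 3 - 2 a_i`. -/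
def theta (D i : ℕ) : ℝ := 3 - 2 * aCoeff D i

/-- The polynomials `u_i`, `0 ≤ i ≤ D`: `u_0 = 1`, `u_1 = λ/3` and
`λ u_i = b_i u_{i+1} + a_i u_i + c_i u_{i-1}` for `1 ≤ i ≤ D - 1`, solved for `u_{i+1}`
(the values at indices above `D` carry no meaning). -/
def u (D : ℕ) : ℕ → ℝ[X]
  | 0 => 1
  | 1 => C (1 / 3) * X
  | i + 2 => C (bCoeff D (i + 1))⁻¹ *
      ((X - C (aCoeff D (i + 1))) * u D (i + 1) - C (cCoeff D (i + 1)) * u D i)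

/-- The three-term recurrence that defines the `u_i`. -/
theorem u_recurrence (D i : ℕ) (h1 : 1 ≤ i) (h2 : i + 1 ≤ D) :
    X * u D i = C (bCoeff D i) * u D (i + 1) + C (aCoeff D i) * u D i
      + C (cCoeff D i) * u D (i - 1) := by
  obtain ⟨k, rfl⟩ : ∃ k, i = k + 1 := ⟨i - 1, by omega⟩
  have hD : (0 : ℝ) < (D : ℝ) - ((k + 1 : ℕ) : ℝ) := by
    rw [sub_pos]; exact_mod_cast h2
  have hD' : (0 : ℝ) < D := by
    have : 0 < D := by omega
    exact_mod_cast this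
  have hb : bCoeff D (k + 1) ≠ 0 := by
    unfold bCoeff
    positivity
  have hC : C (bCoeff D (k + 1)) * C (bCoeff D (k + 1))⁻¹ = (1 : ℝ[X]) := by
    rw [← C_mul, mul_inv_cancel₀ hb, C_1]
  rw [show u D (k + 1 + 1) = C (bCoeff D (k + 1))⁻¹ *
      ((X - C (aCoeff D (k + 1))) * u D (k + 1) - C (cCoeff D (k + 1)) * u D k) by rw [u],
    ← mul_assoc, hC, Nat.add_sub_cancel]
  ring

/-- The set `½ℕ = {0, 1/2, 1, 3/2, …}`. -/
def IsHalfNat (x : ℝ) : Prop := ∃ n : ℕ, x = n / 2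

/-- Admissible triples of elements of `½ℕ`. -/
def Admissible (a b c : ℝ) : Prop :=
  IsHalfNat a ∧ IsHalfNat b ∧ IsHalfNat c ∧ (∃ n : ℕ, a + b + c = n) ∧
    a ≤ b + c ∧ b ≤ c + a ∧ c ≤ a + b

/-- The factorial `x!` as a real number, for a real `x` that is a natural number
(the only arguments at which it is used). -/
def fact (x : ℝ) : ℝ := (⌊x⌋₊ ! : ℝ)

/-- The triangle coefficient `Δ(a,b,c)`, used for admissible `(a,b,c)`. -/
def triangleCoeff (a b c : ℝ) : ℝ :=
  Real.sqrt (fact (a + b - c) * fact (b + c - a) * fact (c + a - b) / fact (a + b + c + 1))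

open Classical in
/-- The Racah coefficient `W(a,b,c,d;e,f)` for `a,…,f ∈ ½ℕ`. Here `β₁ ≤ β₂ ≤ β₃` are the
numbers `a+b+c+d`, `a+d+e+f`, `b+c+e+f` in increasing order; all arguments of `fact`, and the
exponent of `-1`, are integers when the four triples are admissible. -/
def racahW (a b c d e f : ℝ) : ℝ :=
  if Admissible a b e ∧ Admissible c d e ∧ Admissible a c f ∧ Admissible b d f then
    let α₁ := a + b + e
    let α₂ := c + d + e
    let α₃ := a + c + f
    let α₄ := b + d + f
    let x := a + b + c + d
    let y := a + d + e + f
    let z := b + c + e + f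
    let β₁ := min x (min y z)
    let β₃ := max x (max y z)
    let β₂ := x + y + z - β₁ - β₃
    triangleCoeff a b e * triangleCoeff c d e * triangleCoeff a c f * triangleCoeff b d f *
        fact (β₁ + 1) * (-1 : ℝ) ^ ⌊β₁ - (a + b + c + d)⌋ /
      (fact (β₂ - β₁) * fact (β₃ - β₁) * fact (β₁ - α₁) * fact (β₁ - α₂) * fact (β₁ - α₃) *
        fact (β₁ - α₄)) *
      hyp4F3 (α₁ - β₁) (α₂ - β₁) (α₃ - β₁) (α₄ - β₁) (-β₁ - 1) (β₂ - β₁ + 1) (β₃ - β₁ + 1) 1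
  else 0

end RacahKT

end

/-! The values `u_t(θ_i)` form a terminating `₄F₃` that is symmetric in `t` and `i` (`eval_u_theta`,
`racahPoly_comm`). By this self-duality the three-term recurrence also acts on the index `h` of the
triple sum `T(h,i,j)`, where it inserts a factor `θ_t` under the sum. The same factor appears if it
acts on `i` instead, so `T` satisfies a discrete wave equation (`tripleSum_wave`). Since `b_h ≠ 0`
for `h < D`, this equation, the symmetry of `T` and its values at `h = 0` determine `T`. Those
values are the orthogonality relations for the weight `2t+1`.

It remains to see that `(D+1)³W²` has the same symmetry, initial values and wave equation. Up to an
explicit weight it is the square of Racah's alternating sum `S`. Creative telescoping expresses `S`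
at `h+1` and at `h-1` through `S` and one companion sum `V` at `h` (`racahSum_succ`,
`racahSum_pred`). The tridiagonal operator in `h` therefore turns weight times `S²` into weight
times a quadratic form in `S` and `V`, and the wave equation says that this form is symmetric in `h`
and `i` (`waveForm_swap`). This handles strict triangles; at the boundary `S` has at most one
nonzero term and is explicit (`racahSq_wave`). Induction on the smallest index gives
`tripleSum_eq_racahSq`, and `racahSq_eq_racahW` identifies the result with the hypergeometric
definition of `W`. -/

noncomputable section

namespace RacahKT

/-! ### Self-dual Racah polynomials and their recurrence. -/

/-- `(-t)_n (t+1)_n`. -/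
def racahBasis (n : ℕ) (t : ℝ) : ℝ := ∏ k ∈ Finset.range n, ((k : ℝ) * (k + 1) - t * (t + 1))

/-- `(-D)_n (D+2)_n n!²`. -/
def racahDenom (D n : ℕ) : ℝ :=
  ∏ k ∈ Finset.range n, (((k : ℝ) - D) * (D + 2 + k) * (k + 1) ^ 2)

/-- The self-dual Racah polynomial `₄F₃[-t, t+1, -i, i+1; 1, -D, D+2; 1]`. -/
def racahPoly (D t i : ℕ) : ℝ :=
  ∑ n ∈ Finset.range (D + 1), racahBasis n t * racahBasis n i / racahDenom D n

theorem racahPoly_comm (D t i : ℕ) : racahPoly D t i = racahPoly D i t := by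
  unfold racahPoly
  exact Finset.sum_congr rfl fun n _ => by rw [mul_comm]

theorem racahBasis_succ (n : ℕ) (t : ℝ) :
    racahBasis (n + 1) t = ((n : ℝ) * (n + 1) - t * (t + 1)) * racahBasis n t := by
  rw [racahBasis, Finset.prod_range_succ, mul_comm, racahBasis]

theorem racahBasis_succ_add_one (n : ℕ) (t : ℝ) :
    racahBasis (n + 1) (t + 1) = -((t + n + 2) * (t + n + 1)) * racahBasis n t := by
  induction n with
  | zero => simp [racahBasis]; ring
  | succ n ih =>
    rw [racahBasis_succ, ih, racahBasis_succ]
    push_cast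
    ring

theorem racahBasis_neg (n : ℕ) (t : ℝ) : racahBasis n (-1 - t) = racahBasis n t :=
  Finset.prod_congr rfl fun k _ => by ring

theorem racahBasis_succ_sub_one (n : ℕ) (t : ℝ) :
    racahBasis (n + 1) (t - 1) = -((n + 1 - t) * (n - t)) * racahBasis n t := by
  rw [← racahBasis_neg, show -1 - (t - 1) = (-1 - t) + 1 by ring, racahBasis_succ_add_one,
    racahBasis_neg]
  ring

theorem racahBasis_eq_zero {n i : ℕ} (h : i < n) : racahBasis n i = 0 :=
  Finset.prod_eq_zero (Finset.mem_range.2 h) (by ring)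

theorem racahDenom_succ (D n : ℕ) :
    racahDenom D (n + 1) = (((n : ℝ) - D) * (D + 2 + n) * (n + 1) ^ 2) * racahDenom D n := by
  rw [racahDenom, Finset.prod_range_succ, mul_comm, racahDenom]

theorem racahDenom_ne_zero {D n : ℕ} (h : n ≤ D) : racahDenom D n ≠ 0 := by
  refine Finset.prod_ne_zero_iff.2 fun k hk => ?_
  have hk : k < D := lt_of_lt_of_le (Finset.mem_range.1 hk) h
  have : (k : ℝ) < D := by exact_mod_cast hk
  have : (k : ℝ) - D ≠ 0 := by linarith
  positivity

/-- Multiplication by `θ_i` raises the basis index `n` in the variable `i`, while the difference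
operator in `t` lowers it in the variable `t`. Summand by summand the two sides therefore differ by
a telescoping term. -/
theorem racahPoly_recurrence {D : ℕ} (hD : 0 < D) (t i : ℕ) (hi : i ≤ D) :
    bCoeff D t * racahPoly D (t + 1) i + aCoeff D t * racahPoly D t i
      + cCoeff D t * racahPoly D (t - 1) i = theta D i * racahPoly D t i := by
  have hD' : (0 : ℝ) < D := by exact_mod_cast hD
  -- The telescoping primitive. It vanishes at `0` by definition and at `D + 1` because `i ≤ D` is a
  -- zero of the basis function of index `D + 1`.
  set F : ℕ → ℝ := fun n => match n with
    | 0 => 0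
    | n + 1 => racahBasis n t * racahBasis (n + 1) i / racahDenom D n with hF
  have hFD : F (D + 1) = 0 := by simp [hF, racahBasis_eq_zero (Nat.lt_succ_of_le hi)]
  have key : ∀ n ∈ Finset.range (D + 1),
      bCoeff D t * (racahBasis n ((t : ℝ) + 1) * racahBasis n i / racahDenom D n) +
      aCoeff D t * (racahBasis n t * racahBasis n i / racahDenom D n) +
      cCoeff D t * (racahBasis n ((t : ℝ) - 1) * racahBasis n i / racahDenom D n) -
      theta D i * (racahBasis n t * racahBasis n i / racahDenom D n) =
      -6 / (D * (D + 2)) * (F (n + 1) - F n) := by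
    intro n hn
    have hn : n ≤ D := by simpa [Nat.lt_succ_iff] using hn
    cases n with
    | zero =>
      simp only [hF, bCoeff, aCoeff, cCoeff, theta]
      rw [racahBasis_succ]
      simp only [racahBasis, racahDenom, Finset.prod_range_zero]
      push_cast
      field_simp
      ring
    | succ n =>
      have h1 := racahDenom_ne_zero (D := D) (n := n) (by omega)
      have h2 : (n : ℝ) - D ≠ 0 := by
        have : (n : ℝ) < D := by exact_mod_cast hn
        linarith
      simp only [hF]
      rw [racahBasis_succ_add_one, racahBasis_succ_sub_one, racahDenom_succ,
        racahBasis_succ (n + 1) i, racahBasis_succ n i, racahBasis_succ n t]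
      simp only [bCoeff, aCoeff, cCoeff, theta]
      push_cast
      field_simp
      ring
  have hsum := Finset.sum_congr rfl key
  rw [← Finset.mul_sum, Finset.sum_range_sub, hFD, Finset.sum_sub_distrib,
    Finset.sum_add_distrib, Finset.sum_add_distrib, ← Finset.mul_sum, ← Finset.mul_sum,
    ← Finset.mul_sum, ← Finset.mul_sum] at hsum
  -- At `t = 0` the truncated `t - 1` is not the real shift, but `c_0 = 0` makes this harmless.
  have hc : cCoeff D t * racahPoly D (t - 1) i = cCoeff D t * ∑ n ∈ Finset.range (D + 1),
      racahBasis n ((t : ℝ) - 1) * racahBasis n i / racahDenom D n := by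
    cases t with
    | zero => simp [cCoeff]
    | succ t => simp [racahPoly]
  rw [hc]
  simp only [racahPoly]
  push_cast
  have : F 0 = 0 := rfl
  rw [this] at hsum
  linarith

@[simp] theorem racahPoly_zero (D i : ℕ) : racahPoly D 0 i = 1 := by
  rw [racahPoly, Finset.sum_range_succ', Finset.sum_eq_zero fun n _ => by
    rw [racahBasis_eq_zero n.succ_pos, zero_mul, zero_div]]
  simp [racahDenom, racahBasis]

theorem eval_u_theta {D : ℕ} (hD : 0 < D) {i : ℕ} (hi : i ≤ D) :
    ∀ t, t ≤ D → (u D t).eval (theta D i) = racahPoly D t i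
  | 0, _ => by simp [u]
  | 1, _ => by
    have hD' : (0 : ℝ) < D := by exact_mod_cast hD
    have h := racahPoly_recurrence hD 0 i hi
    have hb : bCoeff D 0 = 3 := by simp [bCoeff]; field_simp
    simp only [racahPoly_zero, hb, mul_one] at h
    simp [aCoeff, cCoeff] at h
    simp [u]
    linarith
  | t + 2, ht => by
    have h := racahPoly_recurrence hD (t + 1) i hi
    have hb : bCoeff D (t + 1) ≠ 0 := by
      have : (0 : ℝ) < (D : ℝ) - ((t + 1 : ℕ) : ℝ) := by
        rw [sub_pos]; exact_mod_cast ht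
      have hD' : (0 : ℝ) < D := by exact_mod_cast hD
      unfold bCoeff
      positivity
    rw [u]
    simp only [eval_mul, eval_sub, eval_C, eval_X]
    rw [eval_u_theta hD hi (t + 1) (by omega), eval_u_theta hD hi t (by omega)]
    simp only [Nat.add_sub_cancel] at h
    rw [inv_mul_eq_iff_eq_mul₀ hb]
    linarith

/-! ### Self-adjointness, orthogonality and the wave equation for triple sums. -/

theorem bCoeff_self (D : ℕ) : bCoeff D D = 0 := by simp [bCoeff]

/-- Detailed balance: this makes the tridiagonal operator symmetric for the weight `2t+1`. -/
theorem weight_mul_bCoeff (D t : ℕ) :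
    (2 * (t : ℝ) + 1) * bCoeff D t = (2 * ((t + 1 : ℕ) : ℝ) + 1) * cCoeff D (t + 1) := by
  unfold bCoeff cCoeff
  push_cast
  rcases Nat.eq_zero_or_pos D with rfl | hD
  · simp
  have hD' : (0 : ℝ) < D := by exact_mod_cast hD
  field_simp
  ring

/-- Self-adjointness of the tridiagonal operator for the weight `2t+1`. -/
theorem sum_weight_shift (D : ℕ) (f g : ℕ → ℝ) :
    ∑ t ∈ Finset.range (D + 1), (2 * (t : ℝ) + 1) *
      (bCoeff D t * f (t + 1) + aCoeff D t * f t + cCoeff D t * f (t - 1)) * g t =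
    ∑ t ∈ Finset.range (D + 1), (2 * (t : ℝ) + 1) *
      (bCoeff D t * g (t + 1) + aCoeff D t * g t + cCoeff D t * g (t - 1)) * f t := by
  have h1 : ∀ f g : ℕ → ℝ, ∑ t ∈ Finset.range (D + 1), (2 * (t : ℝ) + 1) * bCoeff D t *
      f (t + 1) * g t = ∑ t ∈ Finset.range (D + 1), (2 * (t : ℝ) + 1) * cCoeff D t *
      g (t - 1) * f t := by
    intro f g
    rw [Finset.sum_range_succ, Finset.sum_range_succ', bCoeff_self]
    simp only [cCoeff, Nat.cast_zero, mul_zero, zero_mul, zero_div, add_zero]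
    refine Finset.sum_congr rfl fun t _ => ?_
    rw [weight_mul_bCoeff, cCoeff, Nat.add_sub_cancel]
    ring
  have e := h1 f g
  have e' := h1 g f
  calc _ = ∑ t ∈ Finset.range (D + 1), (2 * (t : ℝ) + 1) * bCoeff D t * f (t + 1) * g t
      + ∑ t ∈ Finset.range (D + 1), (2 * (t : ℝ) + 1) * aCoeff D t * f t * g t
      + ∑ t ∈ Finset.range (D + 1), (2 * (t : ℝ) + 1) * cCoeff D t * f (t - 1) * g t := by
        simp only [← Finset.sum_add_distrib]
        exact Finset.sum_congr rfl fun t _ => by ring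
    _ = ∑ t ∈ Finset.range (D + 1), (2 * (t : ℝ) + 1) * cCoeff D t * g (t - 1) * f t
      + ∑ t ∈ Finset.range (D + 1), (2 * (t : ℝ) + 1) * aCoeff D t * f t * g t
      + ∑ t ∈ Finset.range (D + 1), (2 * (t : ℝ) + 1) * bCoeff D t * g (t + 1) * f t := by
        rw [e, e']
    _ = _ := by
        simp only [← Finset.sum_add_distrib]
        exact Finset.sum_congr rfl fun t _ => by ring

/-- The weighted sum of triple products of Racah polynomials. -/
def tripleSum (D h i j : ℕ) : ℝ :=
  ∑ t ∈ Finset.range (D + 1),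
    (2 * (t : ℝ) + 1) * racahPoly D t h * racahPoly D t i * racahPoly D t j

theorem tripleSum_swap (D h i j : ℕ) : tripleSum D h i j = tripleSum D i h j :=
  Finset.sum_congr rfl fun t _ => by ring

theorem tripleSum_rotate (D h i j : ℕ) : tripleSum D h i j = tripleSum D i j h :=
  Finset.sum_congr rfl fun t _ => by ring

/-- By self-duality `h` can be read as the degree and `t` as the spectral index. The right-hand side
is symmetric in `h, i, j`, which is the source of the wave equation. -/
theorem tripleSum_theta {D : ℕ} (hD : 0 < D) (h i j : ℕ) :
    bCoeff D h * tripleSum D (h + 1) i j + aCoeff D h * tripleSum D h i j +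
      cCoeff D h * tripleSum D (h - 1) i j =
    ∑ t ∈ Finset.range (D + 1),
      (2 * (t : ℝ) + 1) * theta D t * racahPoly D t h * racahPoly D t i * racahPoly D t j := by
  simp only [tripleSum, Finset.mul_sum, ← Finset.sum_add_distrib]
  refine Finset.sum_congr rfl fun t ht => ?_
  have ht : t ≤ D := by simpa [Nat.lt_succ_iff] using ht
  have := racahPoly_recurrence hD h t ht
  rw [racahPoly_comm D _ t, racahPoly_comm D _ t, racahPoly_comm D _ t] at this
  linear_combination (2 * (t : ℝ) + 1) * racahPoly D t i * racahPoly D t j * this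

theorem tripleSum_wave {D : ℕ} (hD : 0 < D) (h i j : ℕ) :
    bCoeff D h * tripleSum D (h + 1) i j + aCoeff D h * tripleSum D h i j +
      cCoeff D h * tripleSum D (h - 1) i j =
    bCoeff D i * tripleSum D h (i + 1) j + aCoeff D i * tripleSum D h i j +
      cCoeff D i * tripleSum D h (i - 1) j := by
  rw [tripleSum_theta hD, tripleSum_swap D h (i + 1), tripleSum_swap D h i,
    tripleSum_swap D h (i - 1), tripleSum_theta hD]
  exact Finset.sum_congr rfl fun t _ => by ring

theorem theta_injective {D : ℕ} (hD : 0 < D) {i j : ℕ} (h : theta D i = theta D j) : i = j := by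
  have hD' : (0 : ℝ) < D := by exact_mod_cast hD
  unfold theta aCoeff at h
  field_simp at h
  have h2 : ((i : ℝ) - j) * (i + j + 1) = 0 := by nlinarith
  rcases mul_eq_zero.1 h2 with h3 | h3
  · exact_mod_cast sub_eq_zero.1 h3
  · have h4 : (0 : ℝ) < i + j + 1 := by positivity
    exact absurd h3 h4.ne'

/-- Eigenvectors of a self-adjoint operator with distinct eigenvalues are orthogonal. -/
theorem tripleSum_zero_of_ne {D : ℕ} (hD : 0 < D) {i j : ℕ} (hi : i ≤ D) (hj : j ≤ D)
    (hij : i ≠ j) : tripleSum D 0 i j = 0 := by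
  have h := sum_weight_shift D (fun t => racahPoly D t i) (fun t => racahPoly D t j)
  simp only [racahPoly_recurrence hD _ _ hi, racahPoly_recurrence hD _ _ hj] at h
  have h2 : (theta D i - theta D j) * tripleSum D 0 i j = 0 := by
    rw [tripleSum, Finset.mul_sum, ← sub_eq_zero.2 h, ← Finset.sum_sub_distrib]
    refine Finset.sum_congr rfl fun t _ => ?_
    rw [racahPoly_comm D t 0, racahPoly_zero]
    ring
  exact (mul_eq_zero.1 h2).resolve_left fun h3 => hij (theta_injective hD (sub_eq_zero.1 h3))

/-- The wave equation at `(i, i+1, 0)` loses all but two terms by orthogonality. With detailed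
balance this leaves `(2i+3) T(0,i+1,i+1) = (2i+1) T(0,i,i)`, and the start is the sum of the first
`D+1` odd numbers. -/
theorem tripleSum_zero_self {D : ℕ} (hD : 0 < D) :
    ∀ i, i ≤ D → tripleSum D 0 i i = ((D : ℝ) + 1) ^ 2 / (2 * i + 1)
  | 0, _ => by
    have : ∀ n : ℕ, ∑ t ∈ Finset.range n, (2 * (t : ℝ) + 1) = (n : ℝ) ^ 2 := by
      intro n
      induction n with
      | zero => simp
      | succ n ih => rw [Finset.sum_range_succ, ih]; push_cast; ring
    simp only [tripleSum, racahPoly_comm D _ 0, racahPoly_zero, mul_one]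
    rw [this]; push_cast; ring
  | i + 1, hi => by
    have ih := tripleSum_zero_self hD i (by omega)
    have h := tripleSum_wave hD i (i + 1) 0
    rw [← tripleSum_rotate D 0 (i + 1) (i + 1), ← tripleSum_rotate D 0 i (i + 1),
      tripleSum_zero_of_ne hD (i := i) (j := i + 1) (by omega) hi (by omega),
      ← tripleSum_rotate D 0 (i - 1) (i + 1),
      tripleSum_zero_of_ne hD (i := i - 1) (j := i + 1) (by omega) hi (by omega),
      ← tripleSum_rotate D 0 i (i + 1 - 1), Nat.add_sub_cancel, ih,
      ← tripleSum_rotate D 0 i (i + 1 + 1)] at h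
    have h3 : bCoeff D (i + 1) * tripleSum D 0 i (i + 1 + 1) = 0 := by
      rcases Nat.lt_or_ge (i + 1) D with h4 | h4
      · rw [tripleSum_zero_of_ne hD (i := i) (j := i + 1 + 1) (by omega) (by omega) (by omega),
          mul_zero]
      · rw [show i + 1 = D by omega, bCoeff_self, zero_mul]
    rw [h3] at h
    have hw := weight_mul_bCoeff D i
    have hb : bCoeff D i ≠ 0 := by
      have : (0 : ℝ) < (D : ℝ) - i := by
        rw [sub_pos]; exact_mod_cast hi
      have hD' : (0 : ℝ) < D := by exact_mod_cast hD
      unfold bCoeff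
      positivity
    have e1 : cCoeff D (i + 1) = (2 * (i : ℝ) + 1) * bCoeff D i / (2 * ((i + 1 : ℕ) : ℝ) + 1) := by
      rw [eq_div_iff (by positivity), hw]; ring
    rw [e1] at h
    apply mul_left_cancel₀ hb
    simp only [mul_zero, add_zero, zero_add] at h
    rw [h]
    field_simp

/-! ### Racah's single sum and its contiguous relations. -/

/-- The reciprocal factorial `1 / n!`, extended by zero to negative integers. -/
def invFact (n : ℤ) : ℝ := if 0 ≤ n then ((n.toNat ! : ℕ) : ℝ)⁻¹ else 0

/-- The factorial of the nonnegative part of an integer. -/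
def intFact (n : ℤ) : ℝ := ((n.toNat ! : ℕ) : ℝ)

theorem invFact_of_neg {n : ℤ} (hn : n < 0) : invFact n = 0 := by
  simp [invFact, not_le.2 hn]

@[simp] theorem invFact_natCast (n : ℕ) : invFact (n : ℤ) = ((n ! : ℕ) : ℝ)⁻¹ := by
  simp [invFact]

@[simp] theorem intFact_natCast (n : ℕ) : intFact (n : ℤ) = ((n ! : ℕ) : ℝ) := by
  simp [intFact]

/-- Valid for every integer, so the summand identities below need no case analysis on the support of
the sum. -/
theorem invFact_sub_one (n : ℤ) : invFact (n - 1) = n * invFact n := by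
  rcases lt_trichotomy n 0 with hn | rfl | hn
  · rw [invFact_of_neg hn, invFact_of_neg (by omega), mul_zero]
  · rw [invFact_of_neg (by omega)]; simp
  · obtain ⟨k, rfl⟩ : ∃ k : ℕ, n = k + 1 := ⟨(n - 1).toNat, by omega⟩
    have h2 : ((k : ℤ) + 1) = ((k + 1 : ℕ) : ℤ) := by push_cast; ring
    rw [add_sub_cancel_right, h2, invFact_natCast, invFact_natCast, Nat.factorial_succ]
    have := Nat.factorial_ne_zero k
    push_cast
    field_simp

theorem intFact_add_one {n : ℤ} (hn : 0 ≤ n) : intFact (n + 1) = (n + 1) * intFact n := by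
  obtain ⟨k, rfl⟩ := Int.eq_ofNat_of_zero_le hn
  have h2 : ((k : ℤ) + 1) = ((k + 1 : ℕ) : ℤ) := by push_cast; ring
  rw [h2, intFact_natCast, intFact_natCast, Nat.factorial_succ]
  push_cast
  ring

/-- The summand of Racah's single sum; `e` shifts the numerator factorial. -/
def racahTerm (e : ℤ) (D h i j x : ℕ) : ℝ :=
  (-1) ^ x * intFact (D + h + i + j + e - x) * invFact (D - x) *
    (invFact (i + j - x) * invFact (h + j - x) * invFact (h + i - x)) *
    (invFact (x - h) * invFact (x - i) * invFact (x - j))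

/-- Racah's single sum for the parameters `D/2, D/2, D/2, h, i, j`. -/
def racahSum (D h i j : ℕ) : ℝ := ∑ x ∈ Finset.range (D + 1), racahTerm 1 D h i j x

/-- The companion of `racahSum` with the numerator factorials lowered by one. -/
def racahSumLow (D h i j : ℕ) : ℝ := ∑ x ∈ Finset.range (D + 1), racahTerm 0 D h i j x

theorem racahTerm_swap (e : ℤ) (D h i j x : ℕ) : racahTerm e D h i j x = racahTerm e D i h j x := by
  unfold racahTerm
  rw [show (D + h + i + j + e - x : ℤ) = D + i + h + j + e - x by ring,
    add_comm (h : ℤ) i]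
  ring

theorem racahTerm_rotate (e : ℤ) (D h i j x : ℕ) :
    racahTerm e D h i j x = racahTerm e D i j h x := by
  unfold racahTerm
  rw [show (D + h + i + j + e - x : ℤ) = D + i + j + h + e - x by ring,
    add_comm (h : ℤ) i, add_comm (h : ℤ) j]
  ring

theorem racahSum_swap (D h i j : ℕ) : racahSum D h i j = racahSum D i h j :=
  Finset.sum_congr rfl fun x _ => racahTerm_swap 1 D h i j x

theorem racahSum_rotate (D h i j : ℕ) : racahSum D h i j = racahSum D i j h :=
  Finset.sum_congr rfl fun x _ => racahTerm_rotate 1 D h i j x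

theorem racahSumLow_swap (D h i j : ℕ) : racahSumLow D h i j = racahSumLow D i h j :=
  Finset.sum_congr rfl fun x _ => racahTerm_swap 0 D h i j x

/-- Creative telescoping: the combination of summands is `G (x + 1) - G x` for a certificate `G`
vanishing at both ends of the range. -/
theorem racahSum_pred (D h i j : ℕ) :
    ((D : ℝ) - h) * (i + j - h) * racahSum D h i j =
      (h + 1) * ((2 * D + 1 - h + i + j) * racahSum D (h + 1) i j -
        2 * (D + i + 1) * (D + j + 1) * racahSumLow D (h + 1) i j) := by
  set G : ℕ → ℝ := fun x => -((x : ℝ) - i) * (x - j) * racahTerm 1 D (h + 1) i j x with hG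
  have hG0 : G 0 = 0 := by
    have h1 := invFact_sub_one ((0 : ℕ) - i : ℤ)
    rw [invFact_of_neg (by omega)] at h1
    push_cast at h1
    -- This product is the reciprocal factorial at `-i - 1`, hence zero even when `i = 0`.
    have : ((0 : ℕ) - (i : ℝ)) * invFact ((0 : ℕ) - i) = 0 := by push_cast; linarith
    simp only [hG, racahTerm]
    linear_combination (-((0 : ℕ) - (j : ℝ)) * ((-1) ^ 0 *
      intFact (D + (h + 1 : ℕ) + i + j + 1 - (0 : ℕ)) * invFact (D - (0 : ℕ)) *
    (invFact (i + j - (0 : ℕ)) * invFact ((h + 1 : ℕ) + j - (0 : ℕ)) *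
      invFact ((h + 1 : ℕ) + i - (0 : ℕ))) *
    (invFact ((0 : ℕ) - (h + 1 : ℕ)) * invFact ((0 : ℕ) - j)))) * this
  have hGD : G (D + 1) = 0 := by
    simp only [hG, racahTerm]
    rw [invFact_of_neg (n := (D - (D + 1 : ℕ) : ℤ)) (by push_cast; omega)]
    ring
  have key : ∀ x ∈ Finset.range (D + 1),
      ((D : ℝ) - h) * (i + j - h) * racahTerm 1 D h i j x -
      (h + 1) * ((2 * D + 1 - h + i + j) * racahTerm 1 D (h + 1) i j x -
        2 * (D + i + 1) * (D + j + 1) * racahTerm 0 D (h + 1) i j x) = G (x + 1) - G x := by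
    intro x hx
    have hx' : x ≤ D := by simpa [Nat.lt_succ_iff] using hx
    have f1 := intFact_add_one (n := D + h + i + j + 1 - x) (by omega)
    have r1 := invFact_sub_one (D - x)
    have r2 := invFact_sub_one (i + j - x)
    have r3 := invFact_sub_one (h + 1 + j - x)
    have r4 := invFact_sub_one (h + 1 + i - x)
    have r5 := invFact_sub_one (x - h)
    have r6 := invFact_sub_one (x + 1 - i)
    have r7 := invFact_sub_one (x + 1 - j)
    simp only [hG, racahTerm]
    push_cast at *
    rw [show (D + (h + 1) + i + j + 1 - x : ℤ) = D + h + i + j + 1 - x + 1 by ring,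
      show (D + (h + 1) + i + j + 0 - x : ℤ) = D + h + i + j + 1 - x by ring,
      show (D + (h + 1) + i + j + 1 - (x + 1) : ℤ) = D + h + i + j + 1 - x by ring,
      show (D - (x + 1) : ℤ) = D - x - 1 by ring,
      show (i + j - (x + 1) : ℤ) = i + j - x - 1 by ring,
      show (h + 1 + j - (x + 1) : ℤ) = h + 1 + j - x - 1 by ring,
      show (h + 1 + i - (x + 1) : ℤ) = h + 1 + i - x - 1 by ring,
      show (h + j - x : ℤ) = h + 1 + j - x - 1 by ring,
      show (h + i - x : ℤ) = h + 1 + i - x - 1 by ring,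
      show (x + 1 - (h + 1) : ℤ) = x - h by ring,
      show (x - (h + 1) : ℤ) = x - h - 1 by ring,
      show (x - i : ℤ) = x + 1 - i - 1 by ring,
      show (x - j : ℤ) = x + 1 - j - 1 by ring, f1, r1, r2, r3, r4, r5, pow_succ]
    have e1 : ((x : ℝ) + 1 - i) * invFact (x + 1 - i) = invFact (x + 1 - i - 1) := r6.symm
    have e2 : ((x : ℝ) + 1 - j) * invFact (x + 1 - j) = invFact (x + 1 - j - 1) := r7.symm
    rw [show ∀ a b c d e : ℝ, -((x : ℝ) + 1 - i) * (x + 1 - j) * (a * b * c * d * (e *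
      invFact (x + 1 - i) * invFact (x + 1 - j))) = - (a * b * c * d * (e *
      (((x : ℝ) + 1 - i) * invFact (x + 1 - i)) * ((x + 1 - j) * invFact (x + 1 - j)))) by
      intros; ring, e1, e2]
    generalize invFact (x + 1 - i - 1) = A1
    generalize invFact (x + 1 - j - 1) = A2
    ring
  have := Finset.sum_congr rfl key
  rw [Finset.sum_range_sub, hG0, hGD, Finset.sum_sub_distrib, ← Finset.mul_sum, ← Finset.mul_sum,
    Finset.sum_sub_distrib, ← Finset.mul_sum, ← Finset.mul_sum] at this
  unfold racahSum racahSumLow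
  linarith

/-- Creative telescoping again. After the shift rules are applied, every summand and both values of
`G` are polynomial multiples of one common product of factorials, with the linear factor `c` as the
polynomial part of the certificate. -/
theorem racahSum_succ (D h i j : ℕ) :
    ((h : ℝ) + 1) * (h + 1 + j - i) * (h + 1 + i - j) * racahSum D (h + 1) i j =
      (-((h : ℝ) + i + j + 1) * (2 * D + 2 - h + i + j) * (D + h + 1) +
        (2 * h + 1) * (i * (i + 1) + j * (j + 1) - h * (h + 1))) * racahSum D h i j +
      2 * ((D : ℝ) + i + 1) * (D + j + 1) * (h + i + j + 1) * (D + h + 1) *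
        racahSumLow D h i j := by
  set c : ℝ → ℝ := fun x => -((D : ℝ) + i + 1) * (h + 1 + i - j) +
    (2 * D + 3 + h + i + j) * (x - h - j - 1) with hc
  set G : ℕ → ℝ := fun x => c x * ((-1) ^ x * intFact (D + h + i + j + 1 - x) * invFact (D - x) *
    (invFact (i + j - x) * invFact (h + 1 + j - x) * invFact (h + 1 + i - x)) *
    (invFact (x - h - 1) * invFact (x - i - 1) * invFact (x - j - 1))) with hG
  have hG0 : G 0 = 0 := by
    simp only [hG]
    rw [invFact_of_neg (n := ((0 : ℕ) - i - 1 : ℤ)) (by push_cast; omega)]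
    ring
  have hGD : G (D + 1) = 0 := by
    simp only [hG]
    rw [invFact_of_neg (n := (D - (D + 1 : ℕ) : ℤ)) (by push_cast; omega)]
    ring
  have key : ∀ x ∈ Finset.range (D + 1),
      ((h : ℝ) + 1) * (h + 1 + j - i) * (h + 1 + i - j) * racahTerm 1 D (h + 1) i j x -
      ((-((h : ℝ) + i + j + 1) * (2 * D + 2 - h + i + j) * (D + h + 1) +
        (2 * h + 1) * (i * (i + 1) + j * (j + 1) - h * (h + 1))) * racahTerm 1 D h i j x +
      2 * ((D : ℝ) + i + 1) * (D + j + 1) * (h + i + j + 1) * (D + h + 1) *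
        racahTerm 0 D h i j x) = G (x + 1) - G x := by
    intro x hx
    have hx' : x ≤ D := by simpa [Nat.lt_succ_iff] using hx
    have f0 := intFact_add_one (n := D + h + i + j - x) (by omega)
    have f1 := intFact_add_one (n := D + h + i + j - x + 1) (by omega)
    have r1 := invFact_sub_one (D - x)
    have r2 := invFact_sub_one (i + j - x)
    have r3 := invFact_sub_one (h + 1 + j - x)
    have r4 := invFact_sub_one (h + 1 + i - x)
    have r5 := invFact_sub_one (x - h)
    have r6 := invFact_sub_one (x - i)
    have r7 := invFact_sub_one (x - j)
    simp only [hG, hc, racahTerm]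
    push_cast at *
    rw [show (D + (h + 1) + i + j + 1 - x : ℤ) = D + h + i + j - x + 1 + 1 by ring,
      show (D + h + i + j + 0 - x : ℤ) = D + h + i + j - x by ring,
      show (D + h + i + j + 1 - (x + 1) : ℤ) = D + h + i + j - x by ring,
      show (D + h + i + j + 1 - x : ℤ) = D + h + i + j - x + 1 by ring,
      show (D - (x + 1) : ℤ) = D - x - 1 by ring,
      show (i + j - (x + 1) : ℤ) = i + j - x - 1 by ring,
      show (h + 1 + j - (x + 1) : ℤ) = h + 1 + j - x - 1 by ring,
      show (h + 1 + i - (x + 1) : ℤ) = h + 1 + i - x - 1 by ring,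
      show (h + j - x : ℤ) = h + 1 + j - x - 1 by ring,
      show (h + i - x : ℤ) = h + 1 + i - x - 1 by ring,
      show (x + 1 - h - 1 : ℤ) = x - h by ring,
      show (x + 1 - i - 1 : ℤ) = x - i by ring,
      show (x + 1 - j - 1 : ℤ) = x - j by ring,
      show (x - (h + 1) : ℤ) = x - h - 1 by ring,
      f1, f0, r1, r2, r3, r4, r5, r6, r7, pow_succ]
    ring
  have := Finset.sum_congr rfl key
  rw [Finset.sum_range_sub, hG0, hGD, Finset.sum_sub_distrib, ← Finset.mul_sum,
    Finset.sum_add_distrib, ← Finset.mul_sum, ← Finset.mul_sum] at this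
  unfold racahSum racahSumLow
  linarith

theorem racahTerm_eq_zero (e : ℤ) (D : ℕ) {h i j : ℕ} (hij : i + j < h) (x : ℕ) :
    racahTerm e D h i j x = 0 := by
  unfold racahTerm
  rcases Nat.lt_or_ge x h with hx | hx
  · rw [invFact_of_neg (n := (x - h : ℤ)) (by omega)]; ring
  · rw [invFact_of_neg (n := (i + j - x : ℤ)) (by omega)]; ring

theorem racahSum_eq_zero (D : ℕ) {h i j : ℕ} (hij : i + j < h) : racahSum D h i j = 0 :=
  Finset.sum_eq_zero fun x _ => racahTerm_eq_zero 1 D hij x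

theorem racahSum_eq_zero_of_gt {D h : ℕ} (hD : D < h) (i j : ℕ) : racahSum D h i j = 0 := by
  refine Finset.sum_eq_zero fun x hx => ?_
  have := Finset.mem_range.1 hx
  unfold racahTerm
  rw [invFact_of_neg (n := (x - h : ℤ)) (by omega)]; ring

/-- For a degenerate triangle the support conditions `x ≥ j` and `x ≤ h + i` leave only `x = h + i`.
-/
theorem racahTerm_stretched (e : ℕ) {D h i : ℕ} (hD : h + i ≤ D) :
    ∑ x ∈ Finset.range (D + 1), racahTerm e D h i (h + i) x =
      (-1) ^ (h + i) * (D + h + i + e)! / ((D - (h + i))! * ((h ! : ℝ) * i !) ^ 2) := by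
  rw [Finset.sum_eq_single (h + i)]
  · unfold racahTerm
    rw [show ((D : ℤ) + h + i + (h + i : ℕ) + e - (h + i : ℕ)) = ((D + h + i + e : ℕ) : ℤ) by
        push_cast; ring,
      show ((D : ℤ) - (h + i : ℕ)) = ((D - (h + i) : ℕ) : ℤ) by omega,
      show ((i : ℤ) + (h + i : ℕ) - (h + i : ℕ)) = i by ring,
      show ((h : ℤ) + (h + i : ℕ) - (h + i : ℕ)) = h by ring,
      show ((h : ℤ) + i - (h + i : ℕ)) = (0 : ℕ) by push_cast; ring,
      show (((h + i : ℕ) : ℤ) - h) = i by push_cast; ring,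
      show (((h + i : ℕ) : ℤ) - i) = h by push_cast; ring,
      show (((h + i : ℕ) : ℤ) - (h + i : ℕ)) = (0 : ℕ) by push_cast; ring]
    simp only [invFact_natCast, intFact_natCast, Nat.factorial_zero]
    field_simp
    simp
  · intro x _ hx
    unfold racahTerm
    rcases Nat.lt_or_ge x (h + i) with h1 | h1
    · rw [invFact_of_neg (n := (x - (h + i : ℕ) : ℤ)) (by omega)]; ring
    · rw [invFact_of_neg (n := (h + i - x : ℤ)) (by omega)]; ring
  · intro h1
    exact absurd (Finset.mem_range.2 (by omega)) h1

theorem racahSum_stretched {D h i : ℕ} (hD : h + i ≤ D) :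
    racahSum D h i (h + i) =
      (-1) ^ (h + i) * (D + h + i + 1)! / ((D - (h + i))! * ((h ! : ℝ) * i !) ^ 2) := by
  simpa [racahSum] using racahTerm_stretched 1 hD

theorem racahSumLow_stretched {D h i : ℕ} (hD : h + i ≤ D) :
    ((D : ℝ) + h + i + 1) * racahSumLow D h i (h + i) = racahSum D h i (h + i) := by
  have := racahTerm_stretched 0 hD
  rw [racahSum_stretched hD, racahSumLow, show (0 : ℤ) = (0 : ℕ) by rfl, this,
    Nat.factorial_succ]
  push_cast
  ring_nf

/-! ### The squared Racah coefficient under the tridiagonal operator. -/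

/-- `Δ(D/2, D/2, h)²` up to normalisation: `(D-h)! h!² / (D+h+1)!`. -/
def edgeWeight (D h : ℕ) : ℝ := (D - h)! * (h ! : ℝ) ^ 2 / (D + h + 1)!

/-- `Δ(h,i,j)²` for natural numbers. -/
def triangleWeight (h i j : ℕ) : ℝ :=
  (h + i - j)! * (i + j - h)! * (j + h - i)! / (h + i + j + 1)!

/-- The square of all prefactors of Racah's single sum. -/
def racahWeight (D h i j : ℕ) : ℝ :=
  ((D : ℝ) + 1) ^ 3 * triangleWeight h i j * (edgeWeight D h * edgeWeight D i * edgeWeight D j)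

/-- `(D+1)³ W²`. -/
def racahSq (D h i j : ℕ) : ℝ := racahWeight D h i j * racahSum D h i j ^ 2

theorem racahSq_swap (D h i j : ℕ) : racahSq D h i j = racahSq D i h j := by
  unfold racahSq racahWeight triangleWeight
  rw [racahSum_swap, add_comm h i, add_comm i j, add_comm j h]
  ring

theorem racahSq_rotate (D h i j : ℕ) : racahSq D h i j = racahSq D i j h := by
  unfold racahSq racahWeight triangleWeight
  rw [racahSum_rotate, show h + i + j + 1 = i + j + h + 1 by ring]
  ring

theorem racahSq_eq_zero (D : ℕ) {h i j : ℕ} (hij : h + i < j) : racahSq D h i j = 0 := by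
  rw [← racahSq_rotate, racahSq, racahSum_eq_zero D hij]; ring

theorem bCoeff_mul_edgeWeight {D h : ℕ} (hh : h < D) :
    bCoeff D h * edgeWeight D (h + 1) =
      3 / (D * (D + 2)) * ((h + 1) ^ 3 / (2 * h + 1)) * edgeWeight D h := by
  obtain ⟨k, rfl⟩ : ∃ k, D = h + 1 + k := ⟨D - (h + 1), by omega⟩
  unfold bCoeff edgeWeight
  rw [show h + 1 + k - (h + 1) = k by omega, show h + 1 + k - h = k + 1 by omega,
    show h + 1 + k + (h + 1) + 1 = (h + 1 + k + h + 1) + 1 by ring,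
    Nat.factorial_succ k, Nat.factorial_succ h, Nat.factorial_succ (h + 1 + k + h + 1)]
  have := Nat.factorial_ne_zero (h + 1 + k + h + 1)
  push_cast
  field_simp
  ring

theorem cCoeff_mul_edgeWeight {D h : ℕ} (hh : h < D) :
    cCoeff D (h + 1) * edgeWeight D h =
      3 / (D * (D + 2)) * (((D : ℝ) - h) ^ 2 * (D + h + 2) ^ 2 / ((h + 1) * (2 * h + 3))) *
        edgeWeight D (h + 1) := by
  obtain ⟨k, rfl⟩ : ∃ k, D = h + 1 + k := ⟨D - (h + 1), by omega⟩
  unfold cCoeff edgeWeight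
  rw [show h + 1 + k - (h + 1) = k by omega, show h + 1 + k - h = k + 1 by omega,
    show h + 1 + k + (h + 1) + 1 = (h + 1 + k + h + 1) + 1 by ring,
    Nat.factorial_succ k, Nat.factorial_succ h, Nat.factorial_succ (h + 1 + k + h + 1)]
  have := Nat.factorial_ne_zero (h + 1 + k + h + 1)
  push_cast
  field_simp
  ring

theorem triangleWeight_succ {h i j : ℕ} (h1 : h < i + j) (h2 : i ≤ h + j) (h3 : j ≤ h + i) :
    ((i : ℝ) + j - h) * (h + i + j + 2) * triangleWeight (h + 1) i j =
      (h + 1 + i - j) * (h + 1 + j - i) * triangleWeight h i j := by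
  obtain ⟨p, hp⟩ : ∃ p, i + j = h + 1 + p := ⟨i + j - (h + 1), by omega⟩
  obtain ⟨q, hq⟩ : ∃ q, h + j = i + q := ⟨h + j - i, by omega⟩
  obtain ⟨r, hr⟩ : ∃ r, h + i = j + r := ⟨h + i - j, by omega⟩
  have hp' : (i : ℝ) + j = h + 1 + p := by exact_mod_cast hp
  have hq' : (h : ℝ) + j = i + q := by exact_mod_cast hq
  have hr' : (h : ℝ) + i = j + r := by exact_mod_cast hr
  unfold triangleWeight
  rw [show h + 1 + i - j = r + 1 by omega, show i + j - (h + 1) = p by omega,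
    show j + (h + 1) - i = q + 1 by omega, show h + i - j = r by omega,
    show i + j - h = p + 1 by omega, show j + h - i = q by omega,
    show h + 1 + i + j + 1 = (h + i + j + 1) + 1 by ring, Nat.factorial_succ p,
    Nat.factorial_succ q, Nat.factorial_succ r, Nat.factorial_succ (h + i + j + 1),
    show (h : ℝ) + 1 + i - j = r + 1 by linarith, show (h : ℝ) + 1 + j - i = q + 1 by linarith,
    show (i : ℝ) + j - h = p + 1 by linarith]
  have := Nat.factorial_ne_zero (h + i + j + 1)
  push_cast
  field_simp
  ring

/-- The contribution of the raising term to the tridiagonal operator applied to `racahSq`, in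
terms of `S = racahSum` and `V = racahSumLow`, without the weight. -/
def waveUp (D h i j S V : ℝ) : ℝ :=
  (h + 1) / ((2 * h + 1) * (((h + 1 + i - j) * (h + 1 + j - i)) *
        ((i + j - h) * (h + i + j + 2)))) *
      ((-(h + i + j + 1) * (2 * D + 2 - h + i + j) * (D + h + 1) +
        (2 * h + 1) * (i * (i + 1) + j * (j + 1) - h * (h + 1))) * S +
      2 * (D + i + 1) * (D + j + 1) * (h + i + j + 1) * (D + h + 1) * V) ^ 2

/-- The contribution of the lowering term, as in `waveUp`. -/
def waveDown (D h i j S V : ℝ) : ℝ :=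
  (D + h + 1) ^ 2 * h * (h + i + j + 1) /
        ((2 * h + 1) * ((i + j - h + 1) * ((h + i - j) * (h + j - i)))) *
      (((2 * D + 2 - h + i + j) * S - 2 * (D + i + 1) * (D + j + 1) * V)) ^ 2

/-- The tridiagonal operator applied to `racahSq` in its first index, in terms of
`S = racahSum` and `V = racahSumLow`, without the weight. -/
def waveForm (D h i j S V : ℝ) : ℝ :=
  waveUp D h i j S V + h * (h + 1) * S ^ 2 + waveDown D h i j S V

theorem bCoeff_mul_racahSq {D h i j : ℕ} (hh : h ≤ D) (h1 : h < i + j) (h2 : i ≤ h + j)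
    (h3 : j ≤ h + i) :
    bCoeff D h * racahSq D (h + 1) i j =
      3 / (D * (D + 2)) * racahWeight D h i j *
        waveUp D h i j (racahSum D h i j) (racahSumLow D h i j) := by
  rw [waveUp, ← racahSum_succ]
  rcases hh.eq_or_lt with rfl | hh
  -- At `h = D` both sides vanish: `b_D = 0`, and the square in `waveUp` is a multiple of the empty
  -- sum at `D + 1`.
  · rw [bCoeff_self, racahSum_eq_zero_of_gt (Nat.lt_succ_self h)]
    simp only [mul_zero, zero_mul, zero_pow two_ne_zero]
  have n1 : (0 : ℝ) < i + j - h := by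
    have : (h : ℝ) < i + j := by exact_mod_cast h1
    linarith
  have n2 : (0 : ℝ) < h + 1 + j - i := by
    have : (i : ℝ) ≤ h + j := by exact_mod_cast h2
    linarith
  have n3 : (0 : ℝ) < h + 1 + i - j := by
    have : (j : ℝ) ≤ h + i := by exact_mod_cast h3
    linarith
  have n4 : (0 : ℝ) < h + i + j + 2 := by positivity
  have e1 := bCoeff_mul_edgeWeight hh
  have e2 : triangleWeight (h + 1) i j = (h + 1 + i - j) * (h + 1 + j - i) *
      triangleWeight h i j / (((i : ℝ) + j - h) * (h + i + j + 2)) := by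
    rw [eq_div_iff (by positivity), ← triangleWeight_succ h1 h2 h3]; ring
  calc _ = (D + 1) ^ 3 * triangleWeight (h + 1) i j *
        ((bCoeff D h * edgeWeight D (h + 1)) * edgeWeight D i * edgeWeight D j) *
        racahSum D (h + 1) i j ^ 2 := by
        unfold racahSq racahWeight; ring
    _ = _ := by
        rw [e1, e2]
        unfold racahWeight
        generalize racahSum D (h + 1) i j = s
        generalize triangleWeight h i j = t
        generalize edgeWeight D h = u1
        generalize (3 : ℝ) / (D * (D + 2)) = K
        generalize ((D : ℝ) + 1) ^ 3 = K2
        generalize (h : ℝ) + 1 + i - j = x3 at *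
        generalize (h : ℝ) + 1 + j - i = x2 at *
        generalize (i : ℝ) + j - h = x1 at *
        generalize (h : ℝ) + i + j + 2 = x4 at *
        field_simp

theorem cCoeff_mul_racahSq {D h i j : ℕ} (h0 : 0 < h) (hh : h ≤ D) (h1 : h ≤ i + j)
    (h2 : i < h + j) (h3 : j < h + i) :
    cCoeff D h * racahSq D (h - 1) i j =
      3 / (D * (D + 2)) * racahWeight D h i j *
        waveDown D h i j (racahSum D h i j) (racahSumLow D h i j) := by
  obtain ⟨k, rfl⟩ : ∃ k, h = k + 1 := ⟨h - 1, by omega⟩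
  rw [Nat.add_sub_cancel, waveDown]
  have n1 : (0 : ℝ) < i + j - k := by
    have : (k : ℝ) + 1 ≤ i + j := by exact_mod_cast h1
    linarith
  have n2 : (0 : ℝ) < k + 1 + j - i := by
    have : (i : ℝ) < k + 1 + j := by exact_mod_cast h2
    linarith
  have n3 : (0 : ℝ) < k + 1 + i - j := by
    have : (j : ℝ) < k + 1 + i := by exact_mod_cast h3
    linarith
  have n4 : (0 : ℝ) < D - k := by
    have : (k : ℝ) + 1 ≤ D := by exact_mod_cast hh
    linarith
  have n5 : (0 : ℝ) < k + i + j + 2 := by positivity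
  have e0 : (2 * D + 2 - ((k + 1 : ℕ) : ℝ) + i + j) * racahSum D (k + 1) i j -
        2 * (D + i + 1) * (D + j + 1) * racahSumLow D (k + 1) i j =
      ((D : ℝ) - k) * (i + j - k) * racahSum D k i j / (k + 1) := by
    rw [racahSum_pred]
    push_cast
    rw [mul_div_cancel_left₀ _ (by positivity)]
    ring
  rw [e0]
  have e1 := cCoeff_mul_edgeWeight (D := D) (h := k) (by omega)
  have e2 : triangleWeight k i j = (((i : ℝ) + j - k) * (k + i + j + 2)) *
      triangleWeight (k + 1) i j / ((k + 1 + i - j) * (k + 1 + j - i)) := by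
    rw [eq_div_iff (by positivity), triangleWeight_succ (by omega) (by omega) (by omega)]; ring
  calc _ = (D + 1) ^ 3 * triangleWeight k i j *
        ((cCoeff D (k + 1) * edgeWeight D k) * edgeWeight D i * edgeWeight D j) *
        racahSum D k i j ^ 2 := by
        unfold racahSq racahWeight; ring
    _ = _ := by
        rw [e1, e2]
        unfold racahWeight
        generalize racahSum D k i j = s
        generalize triangleWeight (k + 1) i j = t
        generalize edgeWeight D (k + 1) = u1
        generalize (3 : ℝ) / (D * (D + 2)) = K
        generalize ((D : ℝ) + 1) ^ 3 = K2
        push_cast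
        rw [show (i : ℝ) + j - (k + 1) + 1 = i + j - k by ring,
          show (D : ℝ) + (k + 1) + 1 = D + k + 2 by ring,
          show (k : ℝ) + 1 + i + j + 1 = k + i + j + 2 by ring,
          show 2 * ((k : ℝ) + 1) + 1 = 2 * k + 3 by ring]
        generalize (k : ℝ) + 1 + i - j = x3 at *
        generalize (k : ℝ) + 1 + j - i = x2 at *
        generalize (i : ℝ) + j - k = x1 at *
        generalize (k : ℝ) + i + j + 2 = x4 at *
        generalize (D : ℝ) - k = x5 at *
        generalize (D : ℝ) + k + 2 = x6 at *
        field_simp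

/-! ### Symmetry of the quadratic form. -/

/-- The common denominator of `waveForm`. -/
def waveDenom (h i j : ℝ) : ℝ :=
  (((h + 1 + i - j) * (h + 1 + j - i)) * ((i + j - h) * (h + i + j + 2))) *
    ((i + j - h + 1) * ((h + i - j) * (h + j - i)))

/-- Over the common denominator only the coefficient of `Q²` could retain a factor `1/p`, and `hK`
says that it cancels. It is applied with `p = 2h+1`, a factor that is not symmetric in `h` and `i`;
there `K` turns out to be the symmetric `heron`. -/
theorem combine_squares {p X Z : ℝ} (hp : p ≠ 0) (hX : X ≠ 0) (hZ : Z ≠ 0)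
    {h σ K : ℝ} (hK : (h + 1) * σ * Z + h * X = p * K) (H T Q S : ℝ) :
    ((h + 1) / (p * X) * (-σ * Q + p * T * S) ^ 2 + H * S ^ 2 + h * σ / (p * Z) * Q ^ 2) *
      (X * Z) = σ * K * Q ^ 2 - 2 * (h + 1) * σ * T * Z * S * Q +
        (h + 1) * p * T ^ 2 * Z * S ^ 2 + H * (X * Z) * S ^ 2 := by
  field_simp
  linear_combination σ * Q ^ 2 * hK

/-- Sixteen times the squared area of the triangle with sides `√(h(h+1))` and so on. -/
def heron (h i j : ℝ) : ℝ :=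
  2 * (h * (h + 1)) * (i * (i + 1)) + 2 * (h * (h + 1)) * (j * (j + 1)) +
    2 * (i * (i + 1)) * (j * (j + 1)) - (h * (h + 1)) ^ 2 - (i * (i + 1)) ^ 2 -
    (j * (j + 1)) ^ 2

theorem waveForm_mul_waveDenom (D : ℝ) {h i j : ℝ} (S V : ℝ) (h0 : 2 * h + 1 ≠ 0)
    (h1 : h + 1 + i - j ≠ 0) (h2 : h + 1 + j - i ≠ 0) (h3 : i + j - h ≠ 0)
    (h4 : h + i + j + 2 ≠ 0) (h5 : i + j - h + 1 ≠ 0) (h6 : h + i - j ≠ 0)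
    (h7 : h + j - i ≠ 0) :
    waveForm D h i j S V * waveDenom h i j =
      (h + i + j + 1) * heron h i j *
        ((2 * D + 2 - h + i + j) * (D + h + 1) * S -
          2 * (D + i + 1) * (D + j + 1) * (D + h + 1) * V) ^ 2 -
      2 * (h + 1) * (h + i + j + 1) * (i * (i + 1) + j * (j + 1) - h * (h + 1)) *
        ((i + j - h + 1) * ((h + i - j) * (h + j - i))) * S *
        ((2 * D + 2 - h + i + j) * (D + h + 1) * S -
          2 * (D + i + 1) * (D + j + 1) * (D + h + 1) * V) +
      (h + 1) * (2 * h + 1) * (i * (i + 1) + j * (j + 1) - h * (h + 1)) ^ 2 *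
        ((i + j - h + 1) * ((h + i - j) * (h + j - i))) * S ^ 2 +
      h * (h + 1) * waveDenom h i j * S ^ 2 := by
  set Q := (2 * D + 2 - h + i + j) * (D + h + 1) * S -
          2 * (D + i + 1) * (D + j + 1) * (D + h + 1) * V with hQ
  have e1 : waveUp D h i j S V = (h + 1) / ((2 * h + 1) *
        (((h + 1 + i - j) * (h + 1 + j - i)) * ((i + j - h) * (h + i + j + 2)))) *
      (-(h + i + j + 1) * Q + (2 * h + 1) *
        (i * (i + 1) + j * (j + 1) - h * (h + 1)) * S) ^ 2 := by
    rw [waveUp, hQ]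
    congr 2
    ring
  have e2 : waveDown D h i j S V = h * (h + i + j + 1) /
        ((2 * h + 1) * ((i + j - h + 1) * ((h + i - j) * (h + j - i)))) * Q ^ 2 := by
    have : Q = (D + h + 1) * ((2 * D + 2 - h + i + j) * S -
        2 * (D + i + 1) * (D + j + 1) * V) := by rw [hQ]; ring
    rw [waveDown, this]
    generalize ((2 * D + 2 - h + i + j) * S - 2 * (D + i + 1) * (D + j + 1) * V) = Y
    generalize (2 * h + 1) * ((i + j - h + 1) * ((h + i - j) * (h + j - i))) = Z
    ring
  rw [waveForm, e1, e2, waveDenom]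
  refine combine_squares h0 ?_ ?_ ?_ _ _ _ _
  · exact mul_ne_zero (mul_ne_zero h1 h2) (mul_ne_zero h3 h4)
  · exact mul_ne_zero h5 (mul_ne_zero h6 h7)
  · unfold heron; ring

theorem waveForm_swap (D : ℝ) {h i j : ℝ} (S V : ℝ) (hh : 0 < h) (hi : 0 < i) (hj : 0 < j)
    (h1 : h < i + j) (h2 : i < h + j) (h3 : j < h + i) :
    waveForm D h i j S V = waveForm D i h j S V := by
  have n1 : 0 < i + j - h := by linarith
  have n2 : 0 < h + j - i := by linarith
  have n3 : 0 < h + i - j := by linarith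
  have hd : waveDenom h i j ≠ 0 := by
    unfold waveDenom
    have : 0 < h + 1 + i - j := by linarith
    have : 0 < h + 1 + j - i := by linarith
    positivity
  have hd2 : waveDenom h i j = waveDenom i h j := by unfold waveDenom; ring
  -- `M` is symmetric in `h, i, j` and differs from the expression squared on either side by a
  -- multiple of `S`. In the variables `M` and `S` the coefficient of `M²` is visibly symmetric;
  -- `c1` and `c2` are the symmetry of the coefficients of `M S` and `S²`.
  set M := (2 * D ^ 2 + (h + i + j + 4) * D + 2 + h + i + j) * S -
    2 * (D + i + 1) * (D + j + 1) * (D + h + 1) * V with hM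
  have m1 : (2 * D + 2 - h + i + j) * (D + h + 1) * S -
      2 * (D + i + 1) * (D + j + 1) * (D + h + 1) * V = M + (h * (i + j) - h ^ 2) * S := by
    rw [hM]; ring
  have m2 : (2 * D + 2 - i + h + j) * (D + i + 1) * S -
      2 * (D + h + 1) * (D + j + 1) * (D + i + 1) * V = M + (i * (h + j) - i ^ 2) * S := by
    rw [hM]; ring
  have hk : heron i h j = heron h i j := by unfold heron; ring
  have c1 : heron h i j * (h * (i + j) - h ^ 2) -
      (h + 1) * (i * (i + 1) + j * (j + 1) - h * (h + 1)) *
        ((i + j - h + 1) * ((h + i - j) * (h + j - i))) =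
      heron h i j * (i * (h + j) - i ^ 2) -
      (i + 1) * (h * (h + 1) + j * (j + 1) - i * (i + 1)) *
        ((h + j - i + 1) * ((i + h - j) * (i + j - h))) := by
    unfold heron; ring
  have c2 : (h + i + j + 1) * (heron h i j * (h * (i + j) - h ^ 2) ^ 2 -
      2 * (h + 1) * (i * (i + 1) + j * (j + 1) - h * (h + 1)) *
        ((i + j - h + 1) * ((h + i - j) * (h + j - i))) * (h * (i + j) - h ^ 2)) +
      (h + 1) * (2 * h + 1) * (i * (i + 1) + j * (j + 1) - h * (h + 1)) ^ 2 *
        ((i + j - h + 1) * ((h + i - j) * (h + j - i))) + h * (h + 1) * waveDenom h i j =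
      (h + i + j + 1) * (heron h i j * (i * (h + j) - i ^ 2) ^ 2 -
      2 * (i + 1) * (h * (h + 1) + j * (j + 1) - i * (i + 1)) *
        ((h + j - i + 1) * ((i + h - j) * (i + j - h))) * (i * (h + j) - i ^ 2)) +
      (i + 1) * (2 * i + 1) * (h * (h + 1) + j * (j + 1) - i * (i + 1)) ^ 2 *
        ((h + j - i + 1) * ((i + h - j) * (i + j - h))) + i * (i + 1) * waveDenom h i j := by
    unfold heron waveDenom; ring
  apply mul_right_cancel₀ hd
  rw [waveForm_mul_waveDenom, hd2, waveForm_mul_waveDenom, m1, m2, hk, ← hd2,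
    show i + h + j + 1 = h + i + j + 1 by ring]
  · clear_value M
    clear m1 m2 hk hd2 hd
    generalize waveDenom h i j = w at *
    generalize heron h i j = k at *
    generalize ((i + j - h + 1) * ((h + i - j) * (h + j - i))) = z1 at *
    generalize ((h + j - i + 1) * ((i + h - j) * (i + j - h))) = z2 at *
    generalize i * (i + 1) + j * (j + 1) - h * (h + 1) = t1 at *
    generalize h * (h + 1) + j * (j + 1) - i * (i + 1) = t2 at *
    generalize h * (i + j) - h ^ 2 = y1 at *
    generalize i * (h + j) - i ^ 2 = y2 at *
    linear_combination 2 * (h + i + j + 1) * M * S * c1 + S ^ 2 * c2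
  all_goals intro hc; linarith

/-! ### The wave equation for the squared Racah coefficient, and uniqueness. -/

theorem waveForm_eq {D h i j : ℕ} (hh : h ≤ D) (h1 : h < i + j) (h2 : i < h + j)
    (h3 : j < h + i) :
    bCoeff D h * racahSq D (h + 1) i j + aCoeff D h * racahSq D h i j +
      cCoeff D h * racahSq D (h - 1) i j = 3 / (D * (D + 2)) * racahWeight D h i j *
      waveForm D h i j (racahSum D h i j) (racahSumLow D h i j) := by
  rw [bCoeff_mul_racahSq hh h1 h2.le h3.le, cCoeff_mul_racahSq (by omega) hh h1.le h2 h3,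
    waveForm, racahSq, aCoeff]
  ring

theorem racahSq_wave {D h i j : ℕ} (hhi : h < i) (hij : i ≤ j) (hj : j ≤ D) :
    bCoeff D h * racahSq D (h + 1) i j + aCoeff D h * racahSq D h i j +
      cCoeff D h * racahSq D (h - 1) i j =
    bCoeff D i * racahSq D h (i + 1) j + aCoeff D i * racahSq D h i j +
      cCoeff D i * racahSq D h (i - 1) j := by
  have hsw : racahWeight D h i j = racahWeight D i h j := by
    unfold racahWeight triangleWeight
    rw [add_comm h i, add_comm i j, add_comm j h]; ring
  rw [racahSq_swap D h (i + 1), racahSq_swap D h (i - 1)]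
  -- Strict triangles use the symmetry of the form. If `j = h + i`, lowering contributes nothing and
  -- `V` is proportional to `S`. If `j = h + i + 1`, only the raising terms survive and both are
  -- degenerate. Further out every term is zero.
  obtain hlt | rfl | rfl | hgt : j < h + i ∨ j = h + i ∨ j = h + i + 1 ∨ h + i + 1 < j := by omega
  · rw [waveForm_eq (by omega) (by omega) (by omega) hlt, racahSq_swap D h i,
      waveForm_eq (by omega) (by omega) (by omega) (by omega), hsw, ← racahSum_swap D h i,
      ← racahSumLow_swap D h i,
      waveForm_swap]
    all_goals norm_cast <;> omega
  · have hc1 : cCoeff D h * racahSq D (h - 1) i (h + i) = 0 := by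
      cases h with
      | zero => simp [cCoeff]
      | succ h => rw [racahSq_eq_zero D (by omega), mul_zero]
    have hc2 : cCoeff D i * racahSq D (i - 1) h (h + i) = 0 := by
      rw [racahSq_eq_zero D (by omega), mul_zero]
    have hV : racahSumLow D h i (h + i) = racahSum D h i (h + i) / (D + h + i + 1) := by
      rw [eq_div_iff (by positivity), ← racahSumLow_stretched hj]; ring
    have hi0 : (0 : ℝ) < i := by exact_mod_cast (by omega : 0 < i)
    have hD0 : (0 : ℝ) < D := by exact_mod_cast (by omega : 0 < D)
    rw [hc1, hc2, bCoeff_mul_racahSq (by omega) (by omega) (by omega) (by omega), hV]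
    -- For `h = 0` raising `i` leaves the triangle region, so the raising formula does not apply to
    -- it and that term is zero.
    rcases Nat.eq_zero_or_pos h with rfl | hh
    · have hz : racahSq D (i + 1) 0 (0 + i) = 0 := by
        rw [racahSq_rotate]; exact racahSq_eq_zero D (by omega)
      rw [hz, racahSq, aCoeff, aCoeff, waveUp]
      generalize racahSum D 0 i (0 + i) = S
      push_cast
      rw [show (0 : ℝ) + 1 + i - (0 + i) = 1 by ring, show (0 : ℝ) + 1 + (0 + i) - i = 1 by ring,
        show (i : ℝ) + (0 + i) - 0 = 2 * i by ring]
      field_simp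
      ring
    · have hh0 : (0 : ℝ) < h := by exact_mod_cast hh
      rw [bCoeff_mul_racahSq (by omega) (by omega) (by omega) (by omega), ← hsw,
        ← racahSum_swap D h i, ← racahSumLow_swap D h i, hV, racahSq, aCoeff, aCoeff, waveUp, waveUp]
      generalize racahSum D h i (h + i) = S
      push_cast
      rw [show (h : ℝ) + 1 + i - (h + i) = 1 by ring,
        show (h : ℝ) + 1 + (h + i) - i = 2 * h + 1 by ring,
        show (i : ℝ) + 1 + h - (h + i) = 1 by ring,
        show (i : ℝ) + 1 + (h + i) - h = 2 * i + 1 by ring,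
        show (i : ℝ) + (h + i) - h = 2 * i by ring,
        show (h : ℝ) + (h + i) - i = 2 * h by ring]
      field_simp
      ring
  · rw [racahSq_eq_zero D (h := h) (by omega), racahSq_eq_zero D (h := h - 1) (by omega),
      racahSq_eq_zero D (h := i - 1) (by omega), racahSq_swap D (i + 1) h]
    simp only [mul_zero, add_zero]
    have b1 := bCoeff_mul_edgeWeight (D := D) (h := h) (by omega)
    have b2 := bCoeff_mul_edgeWeight (D := D) (h := i) (by omega)
    have s1 := racahSum_stretched (D := D) (h := h + 1) (i := i) (by omega)
    have s2 := racahSum_stretched (D := D) (h := h) (i := i + 1) (by omega)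
    rw [show h + 1 + i = h + i + 1 by ring] at s1
    rw [show h + (i + 1) = h + i + 1 by ring] at s2
    have hD0 : (0 : ℝ) < D := by exact_mod_cast (by omega : 0 < D)
    calc _ = (D + 1) ^ 3 * triangleWeight (h + 1) i (h + i + 1) *
          ((bCoeff D h * edgeWeight D (h + 1)) * edgeWeight D i * edgeWeight D (h + i + 1)) *
          racahSum D (h + 1) i (h + i + 1) ^ 2 := by
          unfold racahSq racahWeight; ring
      _ = (D + 1) ^ 3 * triangleWeight h (i + 1) (h + i + 1) *
          (edgeWeight D h * (bCoeff D i * edgeWeight D (i + 1)) * edgeWeight D (h + i + 1)) *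
          racahSum D h (i + 1) (h + i + 1) ^ 2 := by
          rw [b1, b2, s1, s2]
          unfold triangleWeight
          rw [show h + 1 + i - (h + i + 1) = 0 by omega, show h + (i + 1) - (h + i + 1) = 0 by omega,
            show i + (h + i + 1) - (h + 1) = 2 * i by omega,
            show h + i + 1 + (h + 1) - i = (2 * h + 1) + 1 by omega,
            show i + 1 + (h + i + 1) - h = (2 * i + 1) + 1 by omega,
            show h + i + 1 + h - (i + 1) = 2 * h by omega,
            show h + 1 + i + (h + i + 1) + 1 = h + (i + 1) + (h + i + 1) + 1 by ring,
            show D + (h + 1) + i + 1 = D + h + (i + 1) + 1 by ring,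
            Nat.factorial_succ (2 * h + 1), Nat.factorial_succ (2 * h),
            Nat.factorial_succ (2 * i + 1), Nat.factorial_succ (2 * i),
            Nat.factorial_succ h, Nat.factorial_succ i]
          push_cast
          field_simp
          ring
      _ = _ := by
          unfold racahSq racahWeight; ring
  · rw [racahSq_eq_zero D (h := h) (by omega), racahSq_eq_zero D (h := h - 1) (by omega),
      racahSq_eq_zero D (h := i - 1) (by omega), racahSq_eq_zero D (h := i + 1) (by omega),
      racahSq_eq_zero D (h := h + 1) (by omega)]
    ring

theorem racahSq_zero_left {D : ℕ} {i j : ℕ} (hi : i ≤ D) :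
    racahSq D 0 i j = if i = j then ((D : ℝ) + 1) ^ 2 / (2 * i + 1) else 0 := by
  split_ifs with h
  · subst h
    have hs : ((-1 : ℝ) ^ i) ^ 2 = 1 := by rw [← pow_mul, mul_comm, pow_mul]; norm_num
    have s := racahSum_stretched (D := D) (h := 0) (i := i) (by omega)
    rw [zero_add] at s
    rw [racahSq, s]
    unfold racahWeight triangleWeight edgeWeight
    rw [show 0 + i - i = 0 by omega, show i + i - 0 = 2 * i by omega,
      show i + 0 - i = 0 by omega, show 0 + i + i + 1 = 2 * i + 1 by ring,
      Nat.factorial_succ (2 * i), Nat.sub_zero, Nat.add_zero, Nat.factorial_succ D, div_pow,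
      mul_pow, hs, Nat.add_zero]
    push_cast
    have := Nat.factorial_ne_zero (D - i)
    have := Nat.factorial_ne_zero (D + i + 1)
    simp only [Nat.factorial_zero, Nat.cast_one]
    field_simp
    ring_nf
  · rcases Nat.lt_or_ge i j with h1 | h1
    · exact racahSq_eq_zero D (by omega)
    · rw [racahSq_rotate, racahSq_rotate]
      exact racahSq_eq_zero D (by omega)

/-- Both functions are symmetric, so only `h ≤ i ≤ j` needs the wave equation. There it determines
the value at `h + 1` from values with first index at most `h`, because `b_h ≠ 0`. -/
theorem tripleSum_eq_racahSq {D : ℕ} (hD : 0 < D) :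
    ∀ h, h ≤ D → ∀ i, i ≤ D → ∀ j, j ≤ D → tripleSum D h i j = racahSq D h i j := by
  intro h
  induction h using Nat.strong_induction_on with
  | _ h ih =>
    intro hh
    have key : ∀ i j, h ≤ i → i ≤ j → j ≤ D → tripleSum D h i j = racahSq D h i j := by
      intro i j hhi hij hj
      cases h with
      | zero =>
        rw [racahSq_zero_left (by omega)]
        split_ifs with h
        · subst h; exact tripleSum_zero_self hD i hj
        · exact tripleSum_zero_of_ne hD (by omega) hj h
      | succ h =>
        have w1 := tripleSum_wave hD h i j
        have w2 := racahSq_wave (D := D) (h := h) (i := i) (j := j) (by omega) hij hj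
        have e1 := ih h (by omega) (by omega) i (by omega) j hj
        have e2 := ih (h - 1) (by omega) (by omega) i (by omega) j hj
        have e3 := ih h (by omega) (by omega) (i - 1) (by omega) j hj
        -- The induction hypothesis says nothing about the index `D + 1`; for `i = D` the
        -- coefficient `b_D = 0` removes that term.
        have e4 : bCoeff D i * tripleSum D h (i + 1) j = bCoeff D i * racahSq D h (i + 1) j := by
          rcases Nat.lt_or_ge i D with h4 | h4
          · rw [ih h (by omega) (by omega) (i + 1) (by omega) j hj]
          · rw [show i = D by omega, bCoeff_self, zero_mul, zero_mul]
        have hb : bCoeff D h ≠ 0 := by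
          have : (0 : ℝ) < (D : ℝ) - h := by
            rw [sub_pos]; exact_mod_cast hh
          have hD' : (0 : ℝ) < D := by exact_mod_cast hD
          unfold bCoeff
          positivity
        apply mul_left_cancel₀ hb
        rw [e1, e2, e3, e4] at w1
        linarith
    have key2 : ∀ i j, i ≤ j → i ≤ D → j ≤ D → tripleSum D h i j = racahSq D h i j := by
      intro i j hij hi hj
      rcases Nat.lt_or_ge i h with h1 | h1
      · rw [tripleSum_swap, racahSq_swap, ih i h1 hi h hh j hj]
      · exact key i j h1 hij hj
    intro i hi j hj
    rcases le_total i j with h1 | h1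
    · exact key2 i j h1 hi hj
    · rw [tripleSum_rotate, tripleSum_swap, ← tripleSum_rotate, racahSq_rotate, racahSq_swap,
        ← racahSq_rotate]
      exact key2 j i h1 hj hi

/-! ### From the single sum to the `₄F₃`. -/

theorem poch_zero (a : ℝ) : poch a 0 = 1 := by simp [poch]

theorem poch_succ (a : ℝ) (n : ℕ) : poch a (n + 1) = poch a n * (a + n) := by
  rw [poch, Finset.prod_range_succ, poch]

theorem poch_neg_div_factorial (a n : ℕ) :
    poch (-(a : ℝ)) n / a ! = (-1) ^ n * invFact (a - n) := by
  induction n with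
  | zero => simp [poch_zero]
  | succ n ih =>
    have := invFact_sub_one (a - n)
    rw [poch_succ, mul_div_right_comm, ih,
      show ((a : ℤ) - (n + 1 : ℕ)) = a - n - 1 by push_cast; ring, this]
    push_cast
    ring

theorem poch_neg_eq_zero {a n : ℕ} (h : a < n) : poch (-(a : ℝ)) n = 0 :=
  Finset.prod_eq_zero (Finset.mem_range.2 h) (by ring)

theorem poch_succ_mul_factorial (b n : ℕ) : b ! * poch ((b : ℝ) + 1) n = (b + n)! := by
  induction n with
  | zero => simp [poch_zero]
  | succ n ih =>
    rw [poch_succ, ← mul_assoc, ih, ← add_assoc, Nat.factorial_succ]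
    push_cast
    ring

theorem poch_neg_sub_one {B n : ℕ} (h : n ≤ B + 1) :
    poch (-(B : ℝ) - 1) n = (-1) ^ n * ((B + 1)! / (B + 1 - n)!) := by
  have h1 := poch_neg_div_factorial (B + 1) n
  rw [show ((B + 1 : ℕ) : ℤ) - n = (B + 1 - n : ℕ) by omega, invFact_natCast,
    div_eq_iff (by positivity)] at h1
  rw [show -(B : ℝ) - 1 = -((B + 1 : ℕ) : ℝ) by push_cast; ring, h1]
  ring

/-- A terminating `₄F₃` at one with integral parameters as a finite sum of factorials. -/
theorem factorial_mul_hyp4F3 {a₁ : ℕ} (a₂ a₃ a₄ : ℕ) {B : ℕ} (b₁ b₂ : ℕ) (h : a₁ ≤ B) :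
    ((B + 1)! : ℝ) / (b₁ ! * b₂ ! * a₁ ! * a₂ ! * a₃ ! * a₄ !) *
      hyp4F3 (-(a₁ : ℝ)) (-(a₂ : ℝ)) (-(a₃ : ℝ)) (-(a₄ : ℝ)) (-(B : ℝ) - 1) (b₁ + 1) (b₂ + 1) 1 =
    ∑ n ∈ Finset.range (a₁ + 1), (-1) ^ n * ((B + 1 - n)! : ℝ) * invFact (a₁ - n) *
      invFact (a₂ - n) * invFact (a₃ - n) * invFact (a₄ - n) *
      (((b₁ + n)! : ℝ)⁻¹ * ((b₂ + n)! : ℝ)⁻¹ * (n ! : ℝ)⁻¹) := by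
  rw [hyp4F3, tsum_eq_sum (s := Finset.range (a₁ + 1)), Finset.mul_sum]
  · refine Finset.sum_congr rfl fun n hn => ?_
    have hn : n ≤ a₁ := by simpa [Nat.lt_succ_iff] using hn
    have e1 := poch_neg_div_factorial a₁ n
    have e2 := poch_neg_div_factorial a₂ n
    have e3 := poch_neg_div_factorial a₃ n
    have e4 := poch_neg_div_factorial a₄ n
    have e5 := poch_neg_sub_one (B := B) (n := n) (by omega)
    have e6 := poch_succ_mul_factorial b₁ n
    have e7 := poch_succ_mul_factorial b₂ n
    rw [div_eq_iff (by positivity)] at e1 e2 e3 e4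
    have hs : ((-1 : ℝ) ^ n) * (-1) ^ n = 1 := by rw [← mul_pow]; norm_num
    have f1 := Nat.factorial_ne_zero (B + 1)
    have f2 := Nat.factorial_ne_zero (B + 1 - n)
    have p6 : poch ((b₁ : ℝ) + 1) n = (b₁ + n)! / b₁ ! := by rw [← e6]; field_simp
    have p7 : poch ((b₂ : ℝ) + 1) n = (b₂ + n)! / b₂ ! := by rw [← e7]; field_simp
    have f3 := Nat.factorial_ne_zero (b₁ + n)
    have f4 := Nat.factorial_ne_zero (b₂ + n)
    rw [e1, e2, e3, e4, e5, p6, p7]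
    generalize invFact (a₁ - n) = r1
    generalize invFact (a₂ - n) = r2
    generalize invFact (a₃ - n) = r3
    generalize invFact (a₄ - n) = r4
    -- Four signs come from the upper parameters and one from `-B - 1`, leaving `(-1) ^ n`.
    rcases neg_one_pow_eq_or ℝ n with h0 | h0 <;> rw [h0] <;> field_simp <;> simp
  · intro n hn
    have hn : a₁ < n := by simpa [Nat.lt_succ_iff] using hn
    rw [poch_neg_eq_zero hn]
    simp

@[simp] theorem fact_natCast (n : ℕ) : fact n = n ! := by simp [fact]

/-- When `h` is the largest index the summands vanish for `x < h`, so `n = x - h` is the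
hypergeometric summation index. -/
theorem racahTerm_max_add {D h i j n : ℕ} (hi : i ≤ h) (hj : j ≤ h) (hD : h + n ≤ D) :
    racahTerm 1 D h i j (h + n) = (-1) ^ h * ((-1) ^ n * ((D + i + j + 1 - n)! : ℝ) *
      invFact ((D - h : ℕ) - n) * invFact ((i : ℤ) + j - h - n) * invFact (j - n) *
      invFact (i - n) *
      (((h - i + n)! : ℝ)⁻¹ * ((h - j + n)! : ℝ)⁻¹ * (n ! : ℝ)⁻¹)) := by
  unfold racahTerm
  rw [show (D + h + i + j + 1 - (h + n : ℕ) : ℤ) = (D + i + j + 1 - n : ℕ) by omega,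
    show (D - (h + n : ℕ) : ℤ) = (D - h : ℕ) - n by omega,
    show (i + j - (h + n : ℕ) : ℤ) = (i : ℤ) + j - h - n by omega,
    show (h + j - (h + n : ℕ) : ℤ) = j - n by omega,
    show (h + i - (h + n : ℕ) : ℤ) = i - n by omega,
    show ((h + n : ℕ) - h : ℤ) = n by omega,
    show ((h + n : ℕ) - i : ℤ) = (h - i + n : ℕ) by omega,
    show ((h + n : ℕ) - j : ℤ) = (h - j + n : ℕ) by omega, pow_add]
  simp only [invFact_natCast, intFact_natCast]
  ring

/-- Racah's single sum in hypergeometric form, when the first index is the largest. -/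
theorem racahSum_eq_hyp4F3 {D h i j : ℕ} (hi : i ≤ h) (hj : j ≤ h) (hD : h ≤ D)
    (hij : h ≤ i + j) :
    racahSum D h i j = (-1) ^ h * (((D + i + j + 1)! : ℝ) /
      ((h - i)! * (h - j)! * (D - h)! * (i + j - h)! * j ! * i !) *
      hyp4F3 (-((D - h : ℕ) : ℝ)) (-((i + j - h : ℕ) : ℝ)) (-(j : ℝ)) (-(i : ℝ))
        (-((D + i + j : ℕ) : ℝ) - 1) ((h - i : ℕ) + 1) ((h - j : ℕ) + 1) 1) := by
  rw [factorial_mul_hyp4F3 _ _ _ _ _ (by omega), Finset.mul_sum, racahSum,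
    show D + 1 = h + (D - h + 1) by omega, Finset.sum_range_add, Finset.sum_eq_zero, zero_add]
  · refine Finset.sum_congr rfl fun n hn => ?_
    have hn : n < D - h + 1 := Finset.mem_range.1 hn
    rw [racahTerm_max_add hi hj (by omega),
      show ((i : ℤ) + j - h - n) = ((i + j - h : ℕ) : ℤ) - n by omega]
  · intro x hx
    have hx : x < h := Finset.mem_range.1 hx
    unfold racahTerm
    rw [invFact_of_neg (n := (x - h : ℤ)) (by omega)]; ring

/-! ### Sorting the parameters and identifying `W`. -/

/-- The hypergeometric factor of the Racah coefficient, without signs and triangle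
coefficients. -/
def racahSeries (α₁ α₂ α₃ α₄ β₁ β₂ β₃ : ℝ) : ℝ :=
  fact (β₁ + 1) / (fact (β₂ - β₁) * fact (β₃ - β₁) * fact (β₁ - α₁) * fact (β₁ - α₂) *
    fact (β₁ - α₃) * fact (β₁ - α₄)) *
  hyp4F3 (α₁ - β₁) (α₂ - β₁) (α₃ - β₁) (α₄ - β₁) (-β₁ - 1) (β₂ - β₁ + 1) (β₃ - β₁ + 1) 1

theorem hyp4F3_swap_left (a₁ a₂ a₃ a₄ b₁ b₂ b₃ z : ℝ) :
    hyp4F3 a₁ a₂ a₃ a₄ b₁ b₂ b₃ z = hyp4F3 a₂ a₁ a₃ a₄ b₁ b₂ b₃ z := by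
  unfold hyp4F3; congr 1; ext n; ring

theorem hyp4F3_swap_mid (a₁ a₂ a₃ a₄ b₁ b₂ b₃ z : ℝ) :
    hyp4F3 a₁ a₂ a₃ a₄ b₁ b₂ b₃ z = hyp4F3 a₁ a₃ a₂ a₄ b₁ b₂ b₃ z := by
  unfold hyp4F3; congr 1; ext n; ring

theorem hyp4F3_swap_right (a₁ a₂ a₃ a₄ b₁ b₂ b₃ z : ℝ) :
    hyp4F3 a₁ a₂ a₃ a₄ b₁ b₂ b₃ z = hyp4F3 a₁ a₂ a₄ a₃ b₁ b₂ b₃ z := by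
  unfold hyp4F3; congr 1; ext n; ring

theorem hyp4F3_swap_lower (a₁ a₂ a₃ a₄ b₁ b₂ b₃ z : ℝ) :
    hyp4F3 a₁ a₂ a₃ a₄ b₁ b₂ b₃ z = hyp4F3 a₁ a₂ a₃ a₄ b₁ b₃ b₂ z := by
  unfold hyp4F3; congr 1; ext n; ring

theorem racahSeries_swap_left (α₁ α₂ α₃ α₄ β₁ β₂ β₃ : ℝ) :
    racahSeries α₁ α₂ α₃ α₄ β₁ β₂ β₃ = racahSeries α₂ α₁ α₃ α₄ β₁ β₂ β₃ := by
  unfold racahSeries; rw [hyp4F3_swap_left]; ring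

theorem racahSeries_swap_mid (α₁ α₂ α₃ α₄ β₁ β₂ β₃ : ℝ) :
    racahSeries α₁ α₂ α₃ α₄ β₁ β₂ β₃ = racahSeries α₁ α₃ α₂ α₄ β₁ β₂ β₃ := by
  unfold racahSeries; rw [hyp4F3_swap_mid]; ring

theorem racahSeries_swap_right (α₁ α₂ α₃ α₄ β₁ β₂ β₃ : ℝ) :
    racahSeries α₁ α₂ α₃ α₄ β₁ β₂ β₃ = racahSeries α₁ α₂ α₄ α₃ β₁ β₂ β₃ := by
  unfold racahSeries; rw [hyp4F3_swap_right]; ring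

theorem racahSeries_swap_lower (α₁ α₂ α₃ α₄ β₁ β₂ β₃ : ℝ) :
    racahSeries α₁ α₂ α₃ α₄ β₁ β₂ β₃ = racahSeries α₁ α₂ α₃ α₄ β₁ β₃ β₂ := by
  unfold racahSeries; rw [hyp4F3_swap_lower]; ring

theorem racahSeries_sq {D h i j : ℕ} (hi : i ≤ h) (hj : j ≤ h) (hD : h ≤ D) (hij : h ≤ i + j) :
    racahSeries ((h : ℝ) + i + j) (D + h) (D + i) (D + j) (D + i + j) (D + h + j) (D + h + i) ^ 2 =
      racahSum D h i j ^ 2 := by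
  rw [racahSum_eq_hyp4F3 hi hj hD hij, mul_pow, ← pow_mul, mul_comm h 2, pow_mul, neg_one_sq,
    one_pow, one_mul, racahSeries]
  have c1 : ((D - h : ℕ) : ℝ) = D - h := Nat.cast_sub hD
  have c2 : ((i + j - h : ℕ) : ℝ) = i + j - h := by rw [Nat.cast_sub hij]; push_cast; ring
  have c3 : ((h - i : ℕ) : ℝ) = h - i := Nat.cast_sub hi
  have c4 : ((h - j : ℕ) : ℝ) = h - j := Nat.cast_sub hj
  rw [show (D : ℝ) + i + j + 1 = (D + i + j + 1 : ℕ) by push_cast; ring,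
    show (D : ℝ) + i + j = (D + i + j : ℕ) by push_cast; ring,
    show (D : ℝ) + h + j - (D + i + j : ℕ) = (h - i : ℕ) by rw [c3]; push_cast; ring,
    show (D : ℝ) + h + i - (D + i + j : ℕ) = (h - j : ℕ) by rw [c4]; push_cast; ring,
    show ((D + i + j : ℕ) : ℝ) - (h + i + j) = (D - h : ℕ) by rw [c1]; push_cast; ring,
    show ((D + i + j : ℕ) : ℝ) - (D + h) = (i + j - h : ℕ) by rw [c2]; push_cast; ring,
    show ((D + i + j : ℕ) : ℝ) - (D + i) = j by push_cast; ring,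
    show ((D + i + j : ℕ) : ℝ) - (D + j) = i by push_cast; ring,
    show (h : ℝ) + i + j - (D + i + j : ℕ) = -((D - h : ℕ) : ℝ) by rw [c1]; push_cast; ring,
    show (D : ℝ) + h - (D + i + j : ℕ) = -((i + j - h : ℕ) : ℝ) by rw [c2]; push_cast; ring,
    show (D : ℝ) + i - (D + i + j : ℕ) = -(j : ℝ) by push_cast; ring,
    show (D : ℝ) + j - (D + i + j : ℕ) = -(i : ℝ) by push_cast; ring]
  simp only [fact_natCast]

/-- Symmetry in the last two arguments means that only the minimum has to be located; the order of
the other two is irrelevant. -/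
theorem apply_sort_of_le {f : ℝ → ℝ → ℝ → ℝ} (hf : ∀ a b c, f a b c = f a c b) {x y z m p q : ℝ}
    (hm : min x (min y z) = m) (hM : max x (max y z) = max p q) (hs : x + y + z = m + p + q) :
    f (min x (min y z)) (x + y + z - min x (min y z) - max x (max y z)) (max x (max y z)) =
      f m p q := by
  rw [hm, hM, hs]
  rcases le_total p q with h | h
  · rw [max_eq_right h]; congr 1; ring
  · rw [max_eq_left h, hf]; congr 1; ring

theorem triangleCoeff_sq_of {a b c : ℝ} {p q r s : ℕ} (hp : a + b - c = p) (hq : b + c - a = q)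
    (hr : c + a - b = r) (hs : a + b + c + 1 = s) :
    triangleCoeff a b c ^ 2 = (p ! : ℝ) * q ! * r ! / s ! := by
  rw [triangleCoeff, hp, hq, hr, hs]
  simp only [fact_natCast]
  rw [Real.sq_sqrt (by positivity)]

theorem isHalfNat_natCast (n : ℕ) : IsHalfNat n := ⟨2 * n, by push_cast; ring⟩

theorem admissible_half {D j : ℕ} (hj : j ≤ D) : Admissible ((D : ℝ) / 2) ((D : ℝ) / 2) j := by
  have : (j : ℝ) ≤ D := by exact_mod_cast hj
  have h0 : (0 : ℝ) ≤ j := by positivity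
  exact ⟨⟨D, rfl⟩, ⟨D, rfl⟩, isHalfNat_natCast j, ⟨D + j, by push_cast; ring⟩, by linarith,
    by linarith, by linarith⟩

theorem admissible_half' {D j : ℕ} (hj : j ≤ D) : Admissible ((D : ℝ) / 2) j ((D : ℝ) / 2) := by
  obtain ⟨h1, h2, h3, ⟨n, hn⟩, h5, h6, h7⟩ := admissible_half hj
  exact ⟨h1, h3, h2, ⟨n, by linarith⟩, by linarith, by linarith, by linarith⟩

theorem admissible_natCast {i h j : ℕ} :
    Admissible (i : ℝ) h j ↔ i ≤ h + j ∧ h ≤ j + i ∧ j ≤ i + h := by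
  constructor
  · rintro ⟨-, -, -, -, h5, h6, h7⟩
    exact ⟨by exact_mod_cast h5, by exact_mod_cast h6, by exact_mod_cast h7⟩
  · rintro ⟨h5, h6, h7⟩
    exact ⟨isHalfNat_natCast i, isHalfNat_natCast h, isHalfNat_natCast j,
      ⟨i + h + j, by push_cast; ring⟩, by exact_mod_cast h5, by exact_mod_cast h6,
      by exact_mod_cast h7⟩

theorem edgeWeight_eq_triangleCoeff_sq {D j : ℕ} (hj : j ≤ D) :
    triangleCoeff ((D : ℝ) / 2) ((D : ℝ) / 2) j ^ 2 = edgeWeight D j := by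
  rw [triangleCoeff_sq_of (p := D - j) (q := j) (r := j) (s := D + j + 1), edgeWeight]
  · ring
  all_goals push_cast [hj]; ring

theorem edgeWeight_eq_triangleCoeff_sq' {D j : ℕ} (hj : j ≤ D) :
    triangleCoeff ((D : ℝ) / 2) j ((D : ℝ) / 2) ^ 2 = edgeWeight D j := by
  rw [triangleCoeff_sq_of (p := j) (q := j) (r := D - j) (s := D + j + 1), edgeWeight]
  · ring
  all_goals push_cast [hj]; ring

theorem triangleWeight_eq_triangleCoeff_sq {h i j : ℕ} (h1 : i ≤ h + j) (h2 : h ≤ j + i)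
    (h3 : j ≤ i + h) : triangleCoeff (i : ℝ) h j ^ 2 = triangleWeight i h j := by
  rw [triangleCoeff_sq_of (p := i + h - j) (q := h + j - i) (r := j + i - h)
    (s := i + h + j + 1), triangleWeight]
  · rw [Nat.cast_sub h3]; push_cast; ring
  · rw [Nat.cast_sub h1]; push_cast; ring
  · rw [Nat.cast_sub h2]; push_cast; ring
  · push_cast; ring

theorem racahSeries_sort_sq {D h i j : ℕ} (hh : h ≤ D) (hi : i ≤ D) (hj : j ≤ D)
    (h1 : i ≤ h + j) (h2 : h ≤ j + i) (h3 : j ≤ i + h) {x y z : ℝ} (hx : x = D + i + h)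
    (hy : y = D + h + j) (hz : z = D + i + j) :
    racahSeries (D + j) (i + h + j) (D + i) (D + h) (min x (min y z))
      (x + y + z - min x (min y z) - max x (max y z)) (max x (max y z)) ^ 2 =
      racahSum D h i j ^ 2 := by
  set f : ℝ → ℝ → ℝ → ℝ :=
    fun a b c => racahSeries (D + j) (i + h + j) (D + i) (D + h) a b c ^ 2 with hf
  have hfs : ∀ a b c, f a b c = f a c b := fun a b c => by
    simp only [hf]; rw [racahSeries_swap_lower]
  -- The three candidates for `β₁` are `D` plus two of `h, i, j`; the minimum omits the largest
  -- index.
  have hmax : (i ≤ h ∧ j ≤ h) ∨ (h ≤ i ∧ j ≤ i) ∨ (h ≤ j ∧ i ≤ j) := by omega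
  change f _ _ _ = _
  rcases hmax with ⟨ha, hb⟩ | ⟨ha, hb⟩ | ⟨ha, hb⟩
  all_goals
    have ha' := (Nat.cast_le (α := ℝ)).2 ha
    have hb' := (Nat.cast_le (α := ℝ)).2 hb
  · rw [apply_sort_of_le hfs (m := D + i + j) (p := D + h + j) (q := D + h + i),
      ← racahSeries_sq ha hb hh (by omega)]
    · simp only [hf]
      rw [racahSeries_swap_left, racahSeries_swap_mid, racahSeries_swap_right,
        racahSeries_swap_mid, show (i : ℝ) + h + j = h + i + j by ring]
    · rw [hx, hy, hz, min_eq_right (a := (D : ℝ) + h + j), min_eq_right] <;> linarith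
    · rw [hx, hy, hz, max_eq_left (a := (D : ℝ) + h + j), max_comm,
        show (D : ℝ) + i + h = D + h + i by ring]
      linarith
    · rw [hx, hy, hz]; ring
  · rw [apply_sort_of_le hfs (m := D + h + j) (p := D + i + j) (q := D + i + h),
      racahSum_swap, ← racahSeries_sq ha hb hi (by omega)]
    · simp only [hf]
      rw [racahSeries_swap_left, racahSeries_swap_mid, racahSeries_swap_right]
    · rw [hx, hy, hz, min_eq_left (a := (D : ℝ) + h + j), min_eq_right] <;> linarith
    · rw [hx, hy, hz, max_eq_right (a := (D : ℝ) + h + j), max_comm]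
      linarith
    · rw [hx, hy, hz]; ring
  · rw [apply_sort_of_le hfs (m := D + h + i) (p := D + j + i) (q := D + j + h),
      ← racahSum_rotate, ← racahSeries_sq ha hb hj (by omega)]
    · simp only [hf]
      rw [racahSeries_swap_left, racahSeries_swap_right, show (i : ℝ) + h + j = j + h + i by ring]
    · rw [hx, hy, hz, min_eq_left]
      · ring
      · exact le_min (by linarith) (by linarith)
    · rw [hx, hy, hz, max_eq_right, max_comm, show (D : ℝ) + i + j = D + j + i by ring,
        show (D : ℝ) + h + j = D + j + h by ring]
      exact le_max_of_le_left (by linarith)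
    · rw [hx, hy, hz]; ring

theorem racahSq_eq_racahW {D h i j : ℕ} (hh : h ≤ D) (hi : i ≤ D) (hj : j ≤ D) :
    racahSq D h i j =
      ((D : ℝ) + 1) ^ 3 * racahW ((D : ℝ) / 2) ((D : ℝ) / 2) i h j ((D : ℝ) / 2) ^ 2 := by
  -- Only the triple `(i, h, j)` can fail to be admissible, since the other three are governed by
  -- `h, i, j ≤ D`. When it fails, both sides are zero.
  by_cases hadm : i ≤ h + j ∧ h ≤ j + i ∧ j ≤ i + h
  · obtain ⟨h1, h2, h3⟩ := hadm
    unfold racahW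
    rw [if_pos ⟨admissible_half hj, admissible_natCast.2 ⟨h1, h2, h3⟩, admissible_half' hi,
      admissible_half' hh⟩]
    dsimp only
    have hs := racahSeries_sort_sq hh hi hj h1 h2 h3
      (x := (D : ℝ) / 2 + D / 2 + i + h) (y := (D : ℝ) / 2 + h + j + D / 2)
      (z := (D : ℝ) / 2 + i + j + D / 2) (by ring) (by ring) (by ring)
    rw [show (D : ℝ) / 2 + D / 2 + j = D + j by ring,
      show (D : ℝ) / 2 + i + D / 2 = D + i by ring, show (D : ℝ) / 2 + h + D / 2 = D + h by ring]
    rw [racahSeries] at hs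
    set β := min ((D : ℝ) / 2 + D / 2 + i + h) (min ((D : ℝ) / 2 + h + j + D / 2)
      ((D : ℝ) / 2 + i + j + D / 2))
    set e := ⌊β - ((D : ℝ) / 2 + D / 2 + i + h)⌋
    have hsgn : ((-1 : ℝ) ^ e) ^ 2 = 1 := by
      rw [← zpow_natCast, ← zpow_mul, mul_comm, zpow_mul]; norm_num
    rw [racahSq, racahWeight, ← hs, ← edgeWeight_eq_triangleCoeff_sq hj,
      ← edgeWeight_eq_triangleCoeff_sq' hi, ← edgeWeight_eq_triangleCoeff_sq' hh,
      show triangleWeight h i j = triangleWeight i h j by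
        unfold triangleWeight; rw [add_comm h i, add_comm i j, add_comm j h]; ring,
      ← triangleWeight_eq_triangleCoeff_sq h1 h2 h3]
    clear hs
    generalize (-1 : ℝ) ^ e = s at *
    simp only [mul_pow, div_pow, hsgn]
    ring
  · have hW : racahW ((D : ℝ) / 2) ((D : ℝ) / 2) i h j ((D : ℝ) / 2) = 0 := by
      unfold racahW
      rw [if_neg]
      rintro ⟨-, ha, -⟩
      exact hadm (admissible_natCast.1 ha)
    rw [hW, zero_pow two_ne_zero, mul_zero]
    have : h + j < i ∨ i + j < h ∨ h + i < j := by omega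
    rcases this with hlt | hlt | hlt
    · rw [racahSq_swap, racahSq_rotate]; exact racahSq_eq_zero D hlt
    · rw [racahSq_rotate]; exact racahSq_eq_zero D hlt
    · exact racahSq_eq_zero D hlt

end RacahKT

end

theorem proposition5p7 (D : ℕ) (hD : 0 < D) (h i j : ℕ) (hh : h ≤ D) (hi : i ≤ D) (hj : j ≤ D) :
    ∑ t ∈ Finset.range (D + 1), (2 * (t : ℝ) + 1) *
        (RacahKT.u D t).eval (RacahKT.theta D h) *
        (RacahKT.u D t).eval (RacahKT.theta D i) *
        (RacahKT.u D t).eval (RacahKT.theta D j) =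
      ((D : ℝ) + 1) ^ 3 *
        (RacahKT.racahW ((D : ℝ) / 2) ((D : ℝ) / 2) (i : ℝ) (h : ℝ) (j : ℝ) ((D : ℝ) / 2)) ^ 2 := by
  rw [← RacahKT.racahSq_eq_racahW hh hi hj, ← RacahKT.tripleSum_eq_racahSq hD h hh i hi j hj,
    RacahKT.tripleSum]
  refine Finset.sum_congr rfl fun t ht => ?_
  have ht : t ≤ D := by simpa [Nat.lt_succ_iff] using ht
  rw [RacahKT.eval_u_theta hD hh t ht, RacahKT.eval_u_theta hD hi t ht,
    RacahKT.eval_u_theta hD hj t ht]
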